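/- All algebras are over $\mathbb C$ and unital; comodules are right comodules. A compact Hopf algebra is a Hopf $*$-algebra $H$ (a Hopf algebra that is a $*$-algebra, with $\Delta$ a $*$-homomorphism) such that for every finite-dimensional $H$-comodule with matrix of coefficients $x\in M_n(H)$ there is $K\in GL_n(\mathbb C)$ with $KxK^{-1}$ unitary. A compact $SO(3)$-deformation is a compact Hopf algebra $H$ whose corepresentation semi-ring is isomorphic to that of $SO(3)$, i.e. whose simple comodules, up to isomorphism, form a sequence $(W_n)_{n\in\mathbb N}$ of pairwise non-isomorphic finite-dimensional comodules with $W_0\simeq\mathbb C$ and $$W_n\otimes W_1\simeq W_1\otimes W_n\simeq W_{n-1}\oplus W_n\oplus W_{n+1}\qquad(n\ge 1).$$ A measure on an algebra $A$ is a linear form $\varphi:A\to\mathbb C$ such that the bilinear form $\varphi\circ m:A\otimes A\to\mathbb C$ is non-degenerate, where $m$ is the multiplication. For $A$ finite-dimensional, let $\tilde\delta:\mathbb C\to A\otimes A$ be the dual map of $\varphi\circ m$, that is, $(\varphi m\otimes \mathrm{id})(\mathrm{id}\otimes\tilde\delta)=\mathrm{id}_A=(\mathrm{id}\otimes\varphi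 m)(\tilde\delta\otimes\mathrm{id})$, and put $\tilde\varphi=(\varphi\circ m)\circ(m\otimes\mathrm{id}_A)\circ(\mathrm{id}_A\otimes\tilde\delta)$. The measure $\varphi$ is normalizable if $\varphi(1_A)\ne0$ and $\tilde\varphi=\lambda\varphi$ for some $\lambda\in\mathbb C^*$. **Proposition 3.1.** Let $H$ be a compact $SO(3)$-deformation with simple comodules $(W_n)_{n\in\mathbb N}$ as above, and let $A$ be the $H$-comodule $\mathbb C\oplus W_1$, with coaction $\alpha:A\to A\otimes H$. Then there exist $H$-colinear maps $m:A\otimes A\to A$, $u:\mathbb C\to A$ and $\varphi:A\to\mathbb C$ such that $(A,m,u)$ is an associative unital algebra and $\varphi$ is a measure on it (so that $(A,\varphi)$ is a measured $H$-comodule algebra), and an antilinear map $*:A\to A$ making $A$ a $*$-algebra, such that: 1. $\varphi$ is a faithful state, i.e. $\varphi(1_A)=1$, $\varphi(a^*a)\ge 0$ for all $a\in A$, and $\varphi(a^*a)=0$ only if $a=0$; and $A$ is a $C^*$-algebra for this involution and some norm; 2. $\varphi$ is normalizable; 3. $A$ is an $H$-comodule $*$-algebra: $\alpha(a^*)=\alpha(a)^*$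 for all $a\in A$, where $(a\otimes h)^*=a^*\otimes h^*$. -/

import Mathlib

open scoped TensorProduct ComplexOrder

universe u v

noncomputable section

/-! ### Right comodules over a complex Hopf algebra -/

/-- A right `H`-comodule structure (coaction) `α : V → V ⊗ H` on a complex vector space `V`. -/
structure Coaction (H : Type*) [Ring H] [HopfAlgebra ℂ H]
    (V : Type*) [AddCommGroup V] [Module ℂ V] where
  /-- The underlying linear map `V → V ⊗ H`. -/
  toLin : V →ₗ[ℂ] V ⊗[ℂ] H
  /-- `(α ⊗ id) α = (id ⊗ Δ) α` -/
  coassoc : (TensorProduct.assoc ℂ V H H).toLinearMap ∘ₗ toLin.rTensor H ∘ₗ toLin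
    = (Coalgebra.comul : H →ₗ[ℂ] H ⊗[ℂ] H).lTensor V ∘ₗ toLin
  /-- `(id ⊗ ε) α = id` -/
  counit_comp : (TensorProduct.rid ℂ V).toLinearMap ∘ₗ
    (Coalgebra.counit : H →ₗ[ℂ] ℂ).lTensor V ∘ₗ toLin = LinearMap.id

section Comodules

variable {H : Type*} [Ring H] [HopfAlgebra ℂ H]
variable {V : Type*} [AddCommGroup V] [Module ℂ V]
variable {V' : Type*} [AddCommGroup V'] [Module ℂ V']

/-- `f : V → V'` is a morphism of `H`-comodules: `α' f = (f ⊗ id) α`. -/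
def IsColinear (ρ : Coaction H V) (ρ' : Coaction H V') (f : V →ₗ[ℂ] V') : Prop :=
  ρ'.toLin ∘ₗ f = f.rTensor H ∘ₗ ρ.toLin

/-- Isomorphism of `H`-comodules. -/
def ComoduleIso (ρ : Coaction H V) (ρ' : Coaction H V') : Prop :=
  ∃ f : V ≃ₗ[ℂ] V', IsColinear ρ ρ' f.toLinearMap

/-- `S` is a subcomodule: `α(S) ⊆ S ⊗ H`. -/
def IsSubcomodule (ρ : Coaction H V) (S : Submodule ℂ V) : Prop :=
  ∀ v ∈ S, ρ.toLin v ∈ LinearMap.range (S.subtype.rTensor H)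

/-- A simple comodule: nonzero, with no subcomodules besides `0` and itself. -/
def IsSimpleComodule (ρ : Coaction H V) : Prop :=
  Nontrivial V ∧ ∀ S : Submodule ℂ V, IsSubcomodule ρ S → S = ⊥ ∨ S = ⊤

variable (H) in
/-- The trivial comodule `ℂ`, with coaction `z ↦ z ⊗ 1`. -/
def trivialCoaction : Coaction H ℂ where
  toLin := (TensorProduct.mk ℂ ℂ H).flip 1
  coassoc := by
    ext
    simp [Algebra.TensorProduct.one_def]
  counit_comp := by
    ext
    simp

/-- The linear map underlying the tensor product coaction: `(v ⊗ h) ⊗ (w ⊗ k) ↦ (v ⊗ w) ⊗ hk`. -/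
def tensorCoactionAux (H : Type*) [Ring H] [Algebra ℂ H]
    (V : Type*) [AddCommGroup V] [Module ℂ V] (V' : Type*) [AddCommGroup V'] [Module ℂ V'] :
    (V ⊗[ℂ] H) ⊗[ℂ] (V' ⊗[ℂ] H) →ₗ[ℂ] (V ⊗[ℂ] V') ⊗[ℂ] H :=
  (LinearMap.mul' ℂ H).lTensor (V ⊗[ℂ] V') ∘ₗ
    (TensorProduct.tensorTensorTensorComm ℂ V H V' H).toLinearMap

@[simp] lemma tensorCoactionAux_tmul {H : Type*} [Ring H] [Algebra ℂ H] (v : V) (h : H) (w : V') (k : H) :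
    tensorCoactionAux H V V' ((v ⊗ₜ[ℂ] h) ⊗ₜ[ℂ] (w ⊗ₜ[ℂ] k)) = (v ⊗ₜ[ℂ] w) ⊗ₜ[ℂ] (h * k) := by
  simp [tensorCoactionAux]

/-- The tensor product of two comodules: `v ⊗ w ↦ ∑ (v₍₀₎ ⊗ w₍₀₎) ⊗ v₍₁₎ w₍₁₎`. -/
def Coaction.tensor (ρ : Coaction H V) (ρ' : Coaction H V') : Coaction H (V ⊗[ℂ] V') where
  toLin := tensorCoactionAux H V V' ∘ₗ TensorProduct.map ρ.toLin ρ'.toLin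
  coassoc := by
    have key : ∀ (x : V ⊗[ℂ] H) (y : V' ⊗[ℂ] H),
        TensorProduct.assoc ℂ (V ⊗[ℂ] V') H H
          ((tensorCoactionAux H V V' ∘ₗ TensorProduct.map ρ.toLin ρ'.toLin).rTensor H
            (tensorCoactionAux H V V' (x ⊗ₜ y)))
        = tensorCoactionAux (H ⊗[ℂ] H) V V'
          (TensorProduct.assoc ℂ V H H (ρ.toLin.rTensor H x) ⊗ₜ[ℂ]
            TensorProduct.assoc ℂ V' H H (ρ'.toLin.rTensor H y)) := by
      intro x y
      induction x with
      | zero => simp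
      | add a b ha hb => simp only [map_add, TensorProduct.add_tmul, ha, hb]
      | tmul v h =>
        induction y with
        | zero => simp
        | add a b ha hb => simp only [map_add, TensorProduct.tmul_add, ha, hb]
        | tmul w k =>
          simp only [tensorCoactionAux_tmul, LinearMap.rTensor_tmul, LinearMap.comp_apply,
            TensorProduct.map_tmul]
          generalize ρ.toLin v = a
          generalize ρ'.toLin w = b
          induction a with
          | zero => simp
          | add a b ha hb => simp only [map_add, TensorProduct.add_tmul, ha, hb]
          | tmul v' h' =>
            induction b with
            | zero => simp
            | add a b ha hb =>
              simp only [map_add, TensorProduct.tmul_add, TensorProduct.add_tmul, ha, hb]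
            | tmul w' k' => simp
    have key2 : ∀ (x : V ⊗[ℂ] H) (y : V' ⊗[ℂ] H),
        (Coalgebra.comul : H →ₗ[ℂ] H ⊗[ℂ] H).lTensor (V ⊗[ℂ] V')
            (tensorCoactionAux H V V' (x ⊗ₜ y))
        = tensorCoactionAux (H ⊗[ℂ] H) V V'
          ((Coalgebra.comul : H →ₗ[ℂ] H ⊗[ℂ] H).lTensor V x ⊗ₜ[ℂ]
            (Coalgebra.comul : H →ₗ[ℂ] H ⊗[ℂ] H).lTensor V' y) := by
      intro x y
      induction x with
      | zero => simp
      | add a b ha hb => simp only [map_add, TensorProduct.add_tmul, ha, hb]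
      | tmul v h =>
        induction y with
        | zero => simp
        | add a b ha hb => simp only [map_add, TensorProduct.tmul_add, ha, hb]
        | tmul w k => simp
    apply TensorProduct.ext'
    intro v w
    have h1 := LinearMap.congr_fun ρ.coassoc v
    have h2 := LinearMap.congr_fun ρ'.coassoc w
    simp only [LinearMap.comp_apply, LinearEquiv.coe_coe, TensorProduct.map_tmul] at h1 h2 ⊢
    rw [key2, ← h1, ← h2]
    exact key _ _
  counit_comp := by
    have key : ∀ (x : V ⊗[ℂ] H) (y : V' ⊗[ℂ] H),
        TensorProduct.rid ℂ (V ⊗[ℂ] V')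
          ((Coalgebra.counit : H →ₗ[ℂ] ℂ).lTensor (V ⊗[ℂ] V')
            (tensorCoactionAux H V V' (x ⊗ₜ y)))
        = TensorProduct.rid ℂ V ((Coalgebra.counit : H →ₗ[ℂ] ℂ).lTensor V x) ⊗ₜ[ℂ]
          TensorProduct.rid ℂ V' ((Coalgebra.counit : H →ₗ[ℂ] ℂ).lTensor V' y) := by
      intro x y
      induction x with
      | zero => simp
      | add a b ha hb => simp only [map_add, TensorProduct.add_tmul, ha, hb]
      | tmul v h =>
        induction y with
        | zero => simp
        | add a b ha hb => simp only [map_add, TensorProduct.tmul_add, ha, hb]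
        | tmul w k =>
          simp [TensorProduct.smul_tmul', mul_smul, smul_comm (Coalgebra.counit (R := ℂ) h)]
    apply TensorProduct.ext'
    intro v w
    have h1 := LinearMap.congr_fun ρ.counit_comp v
    have h2 := LinearMap.congr_fun ρ'.counit_comp w
    simp only [LinearMap.comp_apply, LinearEquiv.coe_coe, TensorProduct.map_tmul,
      LinearMap.id_apply] at h1 h2 ⊢
    rw [key, h1, h2]

lemma Coaction.coassoc_of_comp (ρ : Coaction H V) (i : V →ₗ[ℂ] V') (T : V' →ₗ[ℂ] V' ⊗[ℂ] H)
    (hT : T ∘ₗ i = i.rTensor H ∘ₗ ρ.toLin) :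
    (TensorProduct.assoc ℂ V' H H).toLinearMap ∘ₗ T.rTensor H ∘ₗ T ∘ₗ i =
      (Coalgebra.comul : H →ₗ[ℂ] H ⊗[ℂ] H).lTensor V' ∘ₗ T ∘ₗ i := by
  have hc : (TensorProduct.assoc ℂ V' H H).toLinearMap ∘ₗ (i.rTensor H).rTensor H
      = i.rTensor (H ⊗[ℂ] H) ∘ₗ (TensorProduct.assoc ℂ V H H).toLinearMap := by
    ext; simp
  calc _ = (TensorProduct.assoc ℂ V' H H).toLinearMap ∘ₗ (T ∘ₗ i).rTensor H ∘ₗ ρ.toLin := by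
        rw [hT, ← hT, LinearMap.rTensor_comp, LinearMap.comp_assoc, ← hT]
    _ = ((TensorProduct.assoc ℂ V' H H).toLinearMap ∘ₗ (i.rTensor H).rTensor H) ∘ₗ
          ρ.toLin.rTensor H ∘ₗ ρ.toLin := by
        rw [hT, LinearMap.rTensor_comp]; rfl
    _ = i.rTensor (H ⊗[ℂ] H) ∘ₗ (Coalgebra.comul : H →ₗ[ℂ] H ⊗[ℂ] H).lTensor V ∘ₗ ρ.toLin := by
        rw [hc, LinearMap.comp_assoc, ρ.coassoc]
    _ = _ := by
        rw [hT, ← LinearMap.comp_assoc, ← LinearMap.comp_assoc, LinearMap.lTensor_comp_rTensor,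
          LinearMap.rTensor_comp_lTensor]

lemma Coaction.counit_comp_of_comp (ρ : Coaction H V) (i : V →ₗ[ℂ] V')
    (T : V' →ₗ[ℂ] V' ⊗[ℂ] H) (hT : T ∘ₗ i = i.rTensor H ∘ₗ ρ.toLin) :
    (TensorProduct.rid ℂ V').toLinearMap ∘ₗ
      (Coalgebra.counit : H →ₗ[ℂ] ℂ).lTensor V' ∘ₗ T ∘ₗ i = i := by
  have hc : (TensorProduct.rid ℂ V').toLinearMap ∘ₗ i.rTensor ℂ
      = i ∘ₗ (TensorProduct.rid ℂ V).toLinearMap := by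
    ext; simp
  calc _ = ((TensorProduct.rid ℂ V').toLinearMap ∘ₗ i.rTensor ℂ) ∘ₗ
        (Coalgebra.counit : H →ₗ[ℂ] ℂ).lTensor V ∘ₗ ρ.toLin := by
        rw [hT, LinearMap.comp_assoc, ← LinearMap.comp_assoc _ _ (i.rTensor ℂ),
          LinearMap.rTensor_comp_lTensor, ← LinearMap.lTensor_comp_rTensor, LinearMap.comp_assoc]
    _ = i := by rw [hc, LinearMap.comp_assoc, ρ.counit_comp, LinearMap.comp_id]

/-- The direct sum of two comodules: `(v, w) ↦ (ι₁ ⊗ id) α(v) + (ι₂ ⊗ id) α'(w)`. -/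
def Coaction.prod (ρ : Coaction H V) (ρ' : Coaction H V') : Coaction H (V × V') where
  toLin := ((LinearMap.inl ℂ V V').rTensor H ∘ₗ ρ.toLin).coprod
    ((LinearMap.inr ℂ V V').rTensor H ∘ₗ ρ'.toLin)
  coassoc := LinearMap.prod_ext
    (ρ.coassoc_of_comp (LinearMap.inl ℂ V V') _ (LinearMap.coprod_inl _ _))
    (ρ'.coassoc_of_comp (LinearMap.inr ℂ V V') _ (LinearMap.coprod_inr _ _))
  counit_comp := LinearMap.prod_ext
    (ρ.counit_comp_of_comp (LinearMap.inl ℂ V V') _ (LinearMap.coprod_inl _ _))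
    (ρ'.counit_comp_of_comp (LinearMap.inr ℂ V V') _ (LinearMap.coprod_inr _ _))

end Comodules

/-! ### Compact Hopf algebras -/

section Compact

variable (H : Type*) [Ring H] [HopfAlgebra ℂ H]

variable {H} in
/-- `x ∈ M_n(H)` is multiplicative: `Δ(x_ij) = ∑ₖ x_ik ⊗ x_kj` and `ε(x_ij) = δ_ij`. These are
exactly the coefficient matrices (`α(e_j) = ∑ᵢ e_i ⊗ x_ij`) of the `n`-dimensional `H`-comodules
with respect to a basis. -/
def IsMultiplicativeMatrix {n : ℕ} (x : Matrix (Fin n) (Fin n) H) : Prop :=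
  ∀ i j, Coalgebra.comul (R := ℂ) (x i j) = ∑ k, x i k ⊗ₜ[ℂ] x k j ∧
    Coalgebra.counit (R := ℂ) (x i j) = if i = j then 1 else 0

/-- A compact Hopf algebra: a Hopf `*`-algebra (a Hopf algebra and a `*`-algebra over `ℂ` such that
the comultiplication is a `*`-homomorphism, for `(h ⊗ k)* = h* ⊗ k*`) such that the matrix of
coefficients of every finite-dimensional comodule is conjugate, by an invertible complex matrix, to
a unitary matrix. -/
structure IsCompactHopfAlgebra [StarRing H] [StarModule ℂ H] : Prop where
  comul_star : ∀ h : H, Coalgebra.comul (R := ℂ) (star h) = star (Coalgebra.comul (R := ℂ) h)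
  unitarizable : ∀ (n : ℕ) (x : Matrix (Fin n) (Fin n) H), IsMultiplicativeMatrix x →
    ∃ K : GL (Fin n) ℂ,
      (K : Matrix (Fin n) (Fin n) ℂ).map (algebraMap ℂ H) * x *
        ((K⁻¹ : GL (Fin n) ℂ) : Matrix (Fin n) (Fin n) ℂ).map (algebraMap ℂ H)
          ∈ unitary (Matrix (Fin n) (Fin n) H)

/-- `H` has the corepresentation semi-ring of `SO(3)`, with `(W n)ₙ` its family of simple
comodules: the `W n` are finite-dimensional, simple, pairwise non-isomorphic, exhaust the
(finite-dimensional) simple comodules, and satisfy `W 0 ≃ ℂ` and, for `n ≥ 1`,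
`W n ⊗ W 1 ≃ W 1 ⊗ W n ≃ W (n - 1) ⊕ W n ⊕ W (n + 1)`. -/
structure HasSO3Fusion {H : Type u} [Ring H] [HopfAlgebra ℂ H]
    {W : ℕ → Type v} [∀ n, AddCommGroup (W n)] [∀ n, Module ℂ (W n)]
    (ρ : ∀ n, Coaction H (W n)) : Prop where
  finite : ∀ n, FiniteDimensional ℂ (W n)
  simple : ∀ n, IsSimpleComodule (ρ n)
  not_iso : ∀ m n, m ≠ n → ¬ ComoduleIso (ρ m) (ρ n)
  exhaust : ∀ (V : Type v) [AddCommGroup V] [Module ℂ V] [FiniteDimensional ℂ V]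
    (σ : Coaction H V), IsSimpleComodule σ → ∃ n, ComoduleIso σ (ρ n)
  zero : ComoduleIso (ρ 0) (trivialCoaction H)
  fusion_right : ∀ n, ComoduleIso ((ρ (n + 1)).tensor (ρ 1))
    ((ρ n).prod ((ρ (n + 1)).prod (ρ (n + 2))))
  fusion_left : ∀ n, ComoduleIso ((ρ 1).tensor (ρ (n + 1)))
    ((ρ n).prod ((ρ (n + 1)).prod (ρ (n + 2))))

end Compact

/-! ### Measured algebras -/

section Measured

variable {A : Type*} [Ring A] [Algebra ℂ A]

/-- A measure on `A`: a linear form `φ` such that the bilinear form `(a, b) ↦ φ(ab)` is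
nondegenerate. -/
def IsMeasure (φ : A →ₗ[ℂ] ℂ) : Prop :=
  ((LinearMap.mul ℂ A).compr₂ φ).Nondegenerate

/-- `d = δ̃(1) ∈ A ⊗ A`, where `δ̃ : ℂ → A ⊗ A` is the dual map of the bilinear form `φ ∘ m`, i.e.
`(φm ⊗ id)(id ⊗ δ̃) = id = (id ⊗ φm)(δ̃ ⊗ id)`. It is unique when it exists. -/
def IsDualOfForm (φ : A →ₗ[ℂ] ℂ) (d : A ⊗[ℂ] A) : Prop :=
  (∀ a : A, TensorProduct.lid ℂ A (((φ ∘ₗ LinearMap.mul' ℂ A).rTensor A)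
      ((TensorProduct.assoc ℂ A A A).symm (a ⊗ₜ[ℂ] d))) = a) ∧
  (∀ a : A, TensorProduct.rid ℂ A (((φ ∘ₗ LinearMap.mul' ℂ A).lTensor A)
      (TensorProduct.assoc ℂ A A A (d ⊗ₜ[ℂ] a))) = a)

/-- `φ̃ = (φ ∘ m) ∘ (m ⊗ id) ∘ (id ⊗ δ̃)`, where `d = δ̃(1)`. -/
def tildeForm (φ : A →ₗ[ℂ] ℂ) (d : A ⊗[ℂ] A) : A →ₗ[ℂ] ℂ :=
  (φ ∘ₗ LinearMap.mul' ℂ A) ∘ₗ (LinearMap.mul' ℂ A).rTensor A ∘ₗ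
    (TensorProduct.assoc ℂ A A A).symm.toLinearMap ∘ₗ (TensorProduct.mk ℂ A (A ⊗[ℂ] A)).flip d

/-- `φ` is homogeneous: `φ̃ = c φ` for some nonzero scalar `c`. -/
def IsHomogeneousMeasure (φ : A →ₗ[ℂ] ℂ) : Prop :=
  ∃ d : A ⊗[ℂ] A, IsDualOfForm φ d ∧ ∃ c : ℂ, c ≠ 0 ∧ tildeForm φ d = c • φ

/-- `φ` is normalizable: homogeneous with `φ(1) ≠ 0`. -/
def IsNormalizableMeasure (φ : A →ₗ[ℂ] ℂ) : Prop :=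
  IsHomogeneousMeasure φ ∧ φ 1 ≠ 0

/-- A faithful state on a unital `*`-algebra. -/
structure IsFaithfulState [StarRing A] (φ : A →ₗ[ℂ] ℂ) : Prop where
  map_one : φ 1 = 1
  nonneg : ∀ a : A, 0 ≤ φ (star a * a)
  faithful : ∀ a : A, φ (star a * a) = 0 → a = 0

variable {H : Type*} [Ring H] [HopfAlgebra ℂ H]

/-- `(A, φ)` with the coaction `ρ` is a measured `H`-comodule algebra: `φ` is a measure, and the
multiplication `A ⊗ A → A`, the unit `ℂ → A` and `φ : A → ℂ` are `H`-colinear. -/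
structure IsMeasuredComoduleAlgebra (ρ : Coaction H A) (φ : A →ₗ[ℂ] ℂ) : Prop where
  mul_colinear : IsColinear (ρ.tensor ρ) ρ (LinearMap.mul' ℂ A)
  unit_colinear : IsColinear (trivialCoaction H) ρ (Algebra.linearMap ℂ A)
  form_colinear : IsColinear ρ (trivialCoaction H) φ
  isMeasure : IsMeasure φ

/-- The coaction is compatible with the involutions: `α(a*) = α(a)*`, where
`(a ⊗ h)* = a* ⊗ h*`. -/
def IsStarCoaction [StarRing A] [StarModule ℂ A] [StarRing H] [StarModule ℂ H]
    (ρ : Coaction H A) : Prop :=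
  ∀ a : A, ρ.toLin (star a) = star (ρ.toLin a)

end Measured

end

/-! Write W for W₁. The fusion rules and Schur's lemma give a nonzero invariant form t on W and an
invariant product C : W ⊗ W → W, the latter unique up to a scalar. On ℂ ⊕ W put (z, u)(w, v) = (zw +
t(u, v), zv + wu + C(u, v)). This is associative as soon as t(C(u, v), w) = t(u, C(v, w)) and C(C(u,
v), w) + t(u, v)w = C(u, C(v, w)) + t(v, w)u. The work is to rescale t and C so that these hold,
compatibly with an involution.

Involution (`IsCoeffMatrix.exists_isInvolutiveProduct`). Compactness gives a basis with unitary
coefficient matrix, and t(u, v) = ⟨Ju, v⟩ defines an antilinear J compatible with the coaction. By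
Schur J² is a real scalar c ≠ 0. Conjugating C by J gives μC for some μ, which forces c³ = |μ|², so
c > 0; rescaling makes J an involution that reverses C.

Associativity (`IsTrivalent.exists_relation`). The colinear maps W ⊗ W ⊗ W → W are spanned by three
of them, so the four maps C(C(u, v), w), C(u, C(v, w)), t(u, v)w, t(v, w)u satisfy a nontrivial
linear relation. Contracting it with the dual tensor of t and rotating it constrain its
coefficients: C is cyclic for t, and the relation is the wanted one up to a factor p, or a variant
with wrong signs that the pentagon of bracketings excludes. This needs the contraction scalar κ to
be nonzero and the loop value τ to avoid 0, 2 and the roots of X² - X - 1.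

Positivity (`exists_le_sum_form`, `exists_kappa_eq`) supplies these conditions: τ is the squared
Hilbert–Schmidt norm of J, hence at least dim W ≥ 3, and p > 0, so C can be divided by √p, which is
real and preserves the involution. The state is the projection to ℂ: φ(x*x) is a squared Hilbert
norm, GNS gives the C*-norm, and φ̃ = (1 + τ)φ. -/

open scoped TensorProduct ComplexOrder

noncomputable section

/-! ### Colinear maps and Schur's lemma -/

section Colinear

variable {H : Type*} [Ring H] [HopfAlgebra ℂ H]
variable {V V' V'' U U' : Type*} [AddCommGroup V] [Module ℂ V] [AddCommGroup V'] [Module ℂ V']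
  [AddCommGroup V''] [Module ℂ V''] [AddCommGroup U] [Module ℂ U] [AddCommGroup U'] [Module ℂ U']
variable {ρ : Coaction H V} {ρ' : Coaction H V'} {ρ'' : Coaction H V''}
  {σ : Coaction H U} {σ' : Coaction H U'}

lemma Coaction.tensor_tmul (ρ : Coaction H V) (ρ' : Coaction H V') (v : V) (w : V') :
    (ρ.tensor ρ').toLin (v ⊗ₜ w) = tensorCoactionAux H V V' (ρ.toLin v ⊗ₜ ρ'.toLin w) := rfl

lemma tensorCoactionAux_map (f : V →ₗ[ℂ] U) (g : V' →ₗ[ℂ] U') (x : V ⊗[ℂ] H) (y : V' ⊗[ℂ] H) :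
    tensorCoactionAux H U U' (f.rTensor H x ⊗ₜ g.rTensor H y) =
      (TensorProduct.map f g).rTensor H (tensorCoactionAux H V V' (x ⊗ₜ y)) := by
  induction x with
  | zero => simp
  | add a b ha hb => simp only [map_add, TensorProduct.add_tmul, ha, hb]
  | tmul v h =>
    induction y with
    | zero => simp
    | add a b ha hb => simp only [map_add, TensorProduct.tmul_add, ha, hb]
    | tmul w k => simp

namespace IsColinear

lemma apply {f : V →ₗ[ℂ] V'} (hf : IsColinear ρ ρ' f) (v : V) :
    ρ'.toLin (f v) = f.rTensor H (ρ.toLin v) := LinearMap.congr_fun hf v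

lemma id (ρ : Coaction H V) : IsColinear ρ ρ LinearMap.id := by
  simp [IsColinear]

lemma comp {f : V →ₗ[ℂ] V'} {g : V' →ₗ[ℂ] V''} (hg : IsColinear ρ' ρ'' g)
    (hf : IsColinear ρ ρ' f) : IsColinear ρ ρ'' (g ∘ₗ f) := by
  refine LinearMap.ext fun v => ?_
  simp only [LinearMap.comp_apply, hg.apply, hf.apply, LinearMap.rTensor_comp]

lemma add {f g : V →ₗ[ℂ] V'} (hf : IsColinear ρ ρ' f) (hg : IsColinear ρ ρ' g) :
    IsColinear ρ ρ' (f + g) := by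
  refine LinearMap.ext fun v => ?_
  simp only [LinearMap.comp_apply, LinearMap.add_apply, map_add, hf.apply, hg.apply,
    LinearMap.rTensor_add]

lemma smul {f : V →ₗ[ℂ] V'} (c : ℂ) (hf : IsColinear ρ ρ' f) : IsColinear ρ ρ' (c • f) := by
  refine LinearMap.ext fun v => ?_
  simp only [LinearMap.comp_apply, LinearMap.smul_apply, map_smul, hf.apply,
    LinearMap.rTensor_smul]

lemma map {f : V →ₗ[ℂ] U} {g : V' →ₗ[ℂ] U'} (hf : IsColinear ρ σ f) (hg : IsColinear ρ' σ' g) :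
    IsColinear (ρ.tensor ρ') (σ.tensor σ') (TensorProduct.map f g) := by
  refine TensorProduct.ext' fun v w => ?_
  simp only [LinearMap.comp_apply, TensorProduct.map_tmul, Coaction.tensor_tmul, hf.apply,
    hg.apply, tensorCoactionAux_map]

lemma symm {e : V ≃ₗ[ℂ] V'} (h : IsColinear ρ ρ' e.toLinearMap) :
    IsColinear ρ' ρ e.symm.toLinearMap := by
  refine LinearMap.ext fun v => ?_
  obtain ⟨w, rfl⟩ := e.surjective v
  have := h.apply w
  simp only [LinearMap.comp_apply, LinearEquiv.coe_coe] at this ⊢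
  rw [this, ← LinearMap.comp_apply, ← LinearMap.rTensor_comp]
  simp

lemma assoc (ρ : Coaction H V) (ρ' : Coaction H V') (ρ'' : Coaction H V'') :
    IsColinear ((ρ.tensor ρ').tensor ρ'') (ρ.tensor (ρ'.tensor ρ''))
      (TensorProduct.assoc ℂ V V' V'').toLinearMap := by
  refine TensorProduct.ext_threefold fun a b c => ?_
  simp only [LinearMap.comp_apply, LinearEquiv.coe_coe, TensorProduct.assoc_tmul,
    Coaction.tensor_tmul]
  generalize ρ.toLin a = x
  generalize ρ'.toLin b = y
  generalize ρ''.toLin c = z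
  induction x with
  | zero => simp
  | add a b ha hb => simp only [map_add, TensorProduct.add_tmul, ha, hb]
  | tmul v h =>
    induction y with
    | zero => simp
    | add a b ha hb =>
      simp only [map_add, TensorProduct.tmul_add, TensorProduct.add_tmul, ha, hb]
    | tmul w k =>
      induction z with
      | zero => simp
      | add a b ha hb =>
        simp only [map_add, TensorProduct.tmul_add, ha, hb]
      | tmul u l => simp [mul_assoc]

lemma lid (ρ : Coaction H V) : IsColinear ((trivialCoaction H).tensor ρ) ρ
    (TensorProduct.lid ℂ V).toLinearMap := by
  refine TensorProduct.ext' fun z v => ?_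
  simp only [LinearMap.comp_apply, LinearEquiv.coe_coe, TensorProduct.lid_tmul, map_smul,
    Coaction.tensor_tmul, trivialCoaction, LinearMap.flip_apply, TensorProduct.mk_apply]
  generalize ρ.toLin v = x
  induction x with
  | zero => simp
  | add a b ha hb => simp only [map_add, TensorProduct.tmul_add, smul_add, ha, hb]
  | tmul v h => simp [TensorProduct.smul_tmul']

lemma rid (ρ : Coaction H V) : IsColinear (ρ.tensor (trivialCoaction H)) ρ
    (TensorProduct.rid ℂ V).toLinearMap := by
  refine TensorProduct.ext' fun v z => ?_
  simp only [LinearMap.comp_apply, LinearEquiv.coe_coe, TensorProduct.rid_tmul, map_smul,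
    Coaction.tensor_tmul, trivialCoaction, LinearMap.flip_apply, TensorProduct.mk_apply]
  generalize ρ.toLin v = x
  induction x with
  | zero => simp
  | add a b ha hb => simp only [map_add, TensorProduct.add_tmul, smul_add, ha, hb]
  | tmul v h => simp [TensorProduct.smul_tmul']

lemma inl (ρ : Coaction H V) (ρ' : Coaction H V') :
    IsColinear ρ (ρ.prod ρ') (LinearMap.inl ℂ V V') := by
  simp [IsColinear, Coaction.prod]

lemma inr (ρ : Coaction H V) (ρ' : Coaction H V') :
    IsColinear ρ' (ρ.prod ρ') (LinearMap.inr ℂ V V') := by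
  simp [IsColinear, Coaction.prod]

lemma fst (ρ : Coaction H V) (ρ' : Coaction H V') :
    IsColinear (ρ.prod ρ') ρ (LinearMap.fst ℂ V V') := by
  refine LinearMap.prod_ext ?_ ?_
  · rw [Coaction.prod, LinearMap.comp_assoc, LinearMap.comp_assoc, LinearMap.coprod_inl,
      ← LinearMap.comp_assoc ρ.toLin, ← LinearMap.rTensor_comp, LinearMap.fst_comp_inl]
    simp
  · rw [Coaction.prod, LinearMap.comp_assoc, LinearMap.comp_assoc, LinearMap.coprod_inr,
      ← LinearMap.comp_assoc ρ'.toLin, ← LinearMap.rTensor_comp, LinearMap.fst_comp_inr]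
    simp

lemma snd (ρ : Coaction H V) (ρ' : Coaction H V') :
    IsColinear (ρ.prod ρ') ρ' (LinearMap.snd ℂ V V') := by
  refine LinearMap.prod_ext ?_ ?_
  · rw [Coaction.prod, LinearMap.comp_assoc, LinearMap.comp_assoc, LinearMap.coprod_inl,
      ← LinearMap.comp_assoc ρ.toLin, ← LinearMap.rTensor_comp, LinearMap.snd_comp_inl]
    simp
  · rw [Coaction.prod, LinearMap.comp_assoc, LinearMap.comp_assoc, LinearMap.coprod_inr,
      ← LinearMap.comp_assoc ρ'.toLin, ← LinearMap.rTensor_comp, LinearMap.snd_comp_inr]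
    simp

end IsColinear

/-- Since `H` is flat over ℂ, the kernel of `f ⊗ id` is `ker f ⊗ H`. The map `T` need not be a
coaction; this is used later with the conjugate of a comodule, whose axioms then need no proof. -/
lemma isSubcomodule_ker (ρ : Coaction H V) (T : V' →ₗ[ℂ] V' ⊗[ℂ] H) (f : V →ₗ[ℂ] V')
    (hf : T ∘ₗ f = f.rTensor H ∘ₗ ρ.toLin) : IsSubcomodule ρ (LinearMap.ker f) := by
  intro v hv
  have h := LinearMap.congr_fun hf v
  simp only [LinearMap.comp_apply, LinearMap.mem_ker.1 hv, map_zero] at h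
  have hex : Function.Exact (LinearMap.ker f).subtype f := LinearMap.exact_subtype_ker_map f
  exact (Module.Flat.rTensor_exact H hex _).1 h.symm

lemma IsColinear.isSubcomodule_range {f : V →ₗ[ℂ] V'} (hf : IsColinear ρ ρ' f) :
    IsSubcomodule ρ' (LinearMap.range f) := by
  rintro _ ⟨v, rfl⟩
  rw [hf.apply]
  refine ⟨f.rangeRestrict.rTensor H (ρ.toLin v), ?_⟩
  rw [← LinearMap.comp_apply, ← LinearMap.rTensor_comp]
  rfl

lemma IsSimpleComodule.eq_zero_or_injective (hρ : IsSimpleComodule ρ)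
    (T : V' →ₗ[ℂ] V' ⊗[ℂ] H) (f : V →ₗ[ℂ] V') (hf : T ∘ₗ f = f.rTensor H ∘ₗ ρ.toLin) :
    f = 0 ∨ Function.Injective f := by
  rcases hρ.2 _ (isSubcomodule_ker ρ T f hf) with h | h
  · exact Or.inr (LinearMap.ker_eq_bot.1 h)
  · exact Or.inl (LinearMap.ker_eq_top.1 h)

/-- Schur's lemma for non-isomorphic simple comodules. -/
lemma IsColinear.eq_zero_of_not_iso (hρ : IsSimpleComodule ρ) (hρ' : IsSimpleComodule ρ')
    (hn : ¬ ComoduleIso ρ ρ') {f : V →ₗ[ℂ] V'} (hf : IsColinear ρ ρ' f) : f = 0 := by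
  rcases hρ.eq_zero_or_injective _ f hf with h | h
  · exact h
  · rcases hρ'.2 _ hf.isSubcomodule_range with h' | h'
    · exact LinearMap.range_eq_bot.1 h'
    · exact absurd ⟨LinearEquiv.ofBijective f ⟨h, LinearMap.range_eq_top.1 h'⟩, hf⟩ hn

/-- Schur's lemma for endomorphisms of a finite-dimensional simple comodule. -/
lemma IsColinear.exists_eq_smul_id [FiniteDimensional ℂ V] (hρ : IsSimpleComodule ρ)
    {f : V →ₗ[ℂ] V} (hf : IsColinear ρ ρ f) : ∃ c : ℂ, f = c • LinearMap.id := by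
  have := hρ.1
  obtain ⟨c, hc⟩ := Module.End.exists_eigenvalue f
  obtain ⟨v, hv⟩ := hc.exists_hasEigenvector
  refine ⟨c, ?_⟩
  have hg : IsColinear ρ ρ (f + (-c) • LinearMap.id) := hf.add ((IsColinear.id ρ).smul _)
  rcases hρ.eq_zero_or_injective _ _ hg with h | h
  · rw [neg_smul, ← sub_eq_add_neg, sub_eq_zero] at h
    exact h
  · refine absurd (h (a₁ := v) (a₂ := 0) ?_) hv.2
    simp [hv.apply_eq_smul]

lemma ComoduleIso.refl (ρ : Coaction H V) : ComoduleIso ρ ρ :=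
  ⟨LinearEquiv.refl ℂ V, IsColinear.id ρ⟩

end Colinear

/-! ### Relations between a form and a product: trivalent calculus -/

section Trivalent

variable {V : Type*} [AddCommGroup V] [Module ℂ V] {ι : Type*} [Fintype ι]

/-- A bilinear form `t` with dual tensor `∑ eᵢ ⊗ fᵢ` and a bilinear product `C` on `V`, together
with the scalars by which rotations and contractions of `C` act. -/
structure IsTrivalent (t : V →ₗ[ℂ] V →ₗ[ℂ] ℂ) (C : V →ₗ[ℂ] V →ₗ[ℂ] V) (e f : ι → V)
    (ω κ κ' ν τ : ℂ) : Prop where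
  sum_left : ∀ u, ∑ i, t (f i) u • e i = u
  sum_right : ∀ u, ∑ i, t u (e i) • f i = u
  rotate : ∀ u v w, t (C u v) w = ω * t u (C v w)
  sum_mul : ∑ i, C (e i) (f i) = 0
  sum_mul_right : ∀ u, ∑ i, C (C u (e i)) (f i) = κ • u
  sum_mul_left : ∀ u, ∑ i, C (e i) (C (f i) u) = κ' • u
  sum_mul_mul : ∀ u w, ∑ i, C (C u (e i)) (C (f i) w) = ν • C u w
  sum_form : ∑ i, t (e i) (f i) = τ

/-- A linear relation between the four basic trilinear maps built from `t` and `C`. -/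
def TrilinearRelation (t : V →ₗ[ℂ] V →ₗ[ℂ] ℂ) (C : V →ₗ[ℂ] V →ₗ[ℂ] V) (a b c d : ℂ) : Prop :=
  ∀ u v w, a • C (C u v) w + b • C u (C v w) + c • t u v • w + d • t v w • u = 0

namespace IsTrivalent

variable {t : V →ₗ[ℂ] V →ₗ[ℂ] ℂ} {C : V →ₗ[ℂ] V →ₗ[ℂ] V} {e f : ι → V} {ω κ κ' ν τ : ℂ}
  {a b c d : ℂ}

lemma eq_zero_of_form (h : IsTrivalent t C e f ω κ κ' ν τ) {y : V} (hy : ∀ u, t u y = 0) :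
    y = 0 := by
  rw [← h.sum_left y]
  simp [hy]

lemma omega_ne_zero (h : IsTrivalent t C e f ω κ κ' ν τ) (hC : C ≠ 0) : ω ≠ 0 := by
  rintro rfl
  apply hC
  ext u v
  have : ∀ w, t (C u v) w = 0 := fun w => by rw [h.rotate, zero_mul]
  rw [← h.sum_right (C u v)]
  simp [this]

lemma sum_form_left (h : IsTrivalent t C e f ω κ κ' ν τ) (u : V) :
    ∑ i, t (C u (e i)) (f i) = 0 := by
  simp_rw [h.rotate, ← Finset.mul_sum, ← map_sum, h.sum_mul, map_zero, mul_zero]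

lemma sum_form_right (h : IsTrivalent t C e f ω κ κ' ν τ) (hC : C ≠ 0) (u : V) :
    ∑ i, t (e i) (C (f i) u) = 0 := by
  have h1 : ω * ∑ i, t (e i) (C (f i) u) = 0 := by
    simp_rw [Finset.mul_sum, ← h.rotate, ← LinearMap.sum_apply, ← map_sum, h.sum_mul]
    simp
  exact (mul_eq_zero.1 h1).resolve_left (h.omega_ne_zero hC)

/-- Moving both copies of `C` across the form costs one factor ω each and turns the right
contraction into the left one. -/
lemma kappa_eq (h : IsTrivalent t C e f ω κ κ' ν τ) [Nontrivial V] : κ = ω ^ 2 * κ' := by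
  obtain ⟨u, hu⟩ := exists_ne (0 : V)
  have hex : ∃ w, t u w ≠ 0 := by
    by_contra! hw
    apply hu
    rw [← h.sum_right u]
    simp [hw]
  obtain ⟨w, hw⟩ := hex
  have h1 : t (∑ i, C (C u (e i)) (f i)) w = ω ^ 2 * t u (∑ i, C (e i) (C (f i) w)) := by
    simp only [map_sum, LinearMap.sum_apply, Finset.mul_sum, h.rotate]
    exact Finset.sum_congr rfl fun i _ => by ring
  rw [h.sum_mul_right, h.sum_mul_left] at h1
  simp only [map_smul, LinearMap.smul_apply, smul_eq_mul] at h1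
  apply mul_right_cancel₀ hw
  linear_combination h1

/-- This and the next three lemmas insert the dual tensor into a trilinear relation, alone or with
one factor multiplied by `C`. Every term becomes a multiple of a single nonzero map, which leaves
one linear equation on the coefficients. -/
lemma relation_contract_right [Nontrivial V] (h : IsTrivalent t C e f ω κ κ' ν τ)
    (hr : TrilinearRelation t C a b c d) : a * κ + c + d * τ = 0 := by
  obtain ⟨u, hu⟩ := exists_ne (0 : V)
  have h1 := Finset.sum_congr (rfl : Finset.univ = Finset.univ) fun i _ => hr u (e i) (f i)
  simp only [Finset.sum_add_distrib, ← Finset.smul_sum, ← Finset.sum_smul, h.sum_mul_right,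
    ← map_sum, h.sum_mul, h.sum_right, h.sum_form, Finset.sum_const_zero, map_zero, smul_zero,
    add_zero] at h1
  simp only [smul_smul, ← add_smul] at h1
  exact (smul_eq_zero.1 h1).resolve_right hu

lemma relation_contract_left [Nontrivial V] (h : IsTrivalent t C e f ω κ κ' ν τ)
    (hr : TrilinearRelation t C a b c d) : b * κ' + c * τ + d = 0 := by
  obtain ⟨u, hu⟩ := exists_ne (0 : V)
  have h1 := Finset.sum_congr (rfl : Finset.univ = Finset.univ) fun i _ => hr (e i) (f i) u
  simp only [Finset.sum_add_distrib, ← Finset.smul_sum, ← Finset.sum_smul, h.sum_mul_left,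
    ← map_sum, ← LinearMap.sum_apply, h.sum_mul, h.sum_left, h.sum_form, Finset.sum_const_zero,
    map_zero, LinearMap.zero_apply, smul_zero, zero_add] at h1
  simp only [smul_smul, ← add_smul] at h1
  exact (smul_eq_zero.1 h1).resolve_right hu

lemma relation_mul_right (h : IsTrivalent t C e f ω κ κ' ν τ) (hC : C ≠ 0)
    (hr : TrilinearRelation t C a b c d) : a * ν + b * κ' + c = 0 := by
  obtain ⟨u, hu⟩ := DFunLike.ne_iff.1 hC
  obtain ⟨w, hw⟩ := DFunLike.ne_iff.1 hu
  have h1 := Finset.sum_congr (rfl : Finset.univ = Finset.univ)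
    fun i _ => hr u (e i) (C (f i) w)
  have h2 : ∑ i, t u (e i) • C (f i) w = C u w := by
    conv_rhs => rw [← h.sum_right u]
    simp
  simp only [Finset.sum_add_distrib, ← Finset.smul_sum, ← Finset.sum_smul, h.sum_mul_mul,
    ← map_sum, h.sum_mul_left, h2, h.sum_form_right hC, Finset.sum_const_zero,
    map_smul, zero_smul, smul_zero, add_zero] at h1
  simp only [smul_smul, ← add_smul] at h1
  exact (smul_eq_zero.1 h1).resolve_right hw

lemma relation_mul_left (h : IsTrivalent t C e f ω κ κ' ν τ) (hC : C ≠ 0)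
    (hr : TrilinearRelation t C a b c d) : a * κ + b * ν + d = 0 := by
  obtain ⟨u, hu⟩ := DFunLike.ne_iff.1 hC
  obtain ⟨w, hw⟩ := DFunLike.ne_iff.1 hu
  have h1 := Finset.sum_congr (rfl : Finset.univ = Finset.univ)
    fun i _ => hr (C u (e i)) (f i) w
  have h2 : ∑ i, t (f i) w • C u (e i) = C u w := by
    conv_rhs => rw [← h.sum_left w]
    simp
  simp only [Finset.sum_add_distrib, ← Finset.smul_sum, ← Finset.sum_smul, h.sum_mul_mul,
    ← map_sum, ← LinearMap.sum_apply, h.sum_mul_right, h2, h.sum_form_left, Finset.sum_const_zero,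
    map_smul, LinearMap.smul_apply, zero_smul, smul_zero, add_zero] at h1
  simp only [smul_smul, ← add_smul] at h1
  exact (smul_eq_zero.1 h1).resolve_right hw

/-- Pair the relation with a fourth vector and move all products to the right of the form: the two
bracketings exchange roles, as do the two form terms. -/
lemma relation_rotate (h : IsTrivalent t C e f ω κ κ' ν τ)
    (hr : TrilinearRelation t C a b c d) :
    TrilinearRelation t C (b * ω) (a * ω ^ 2) d c := by
  intro v w z
  apply h.eq_zero_of_form
  intro u
  have h1 := congrArg (fun y => t y z) (hr u v w)
  simp only [map_add, map_smul, LinearMap.add_apply, LinearMap.smul_apply, smul_eq_mul, h.rotate,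
    map_zero, LinearMap.zero_apply] at h1 ⊢
  linear_combination h1

/-- With b = 0 the contractions give aκ + c + dτ = 0, cτ + d = 0 and aκ + d = 0; eliminating a and d
leaves c(τ² - τ - 1) = 0. Consequently two relations can be compared by cancelling their b-terms. -/
lemma relation_eq_zero [Nontrivial V] (h : IsTrivalent t C e f ω κ κ' ν τ) (hC : C ≠ 0)
    (hκ : κ ≠ 0) (hτ : τ ^ 2 - τ - 1 ≠ 0)
    (hr : TrilinearRelation t C a 0 c d) : a = 0 ∧ c = 0 ∧ d = 0 := by
  have h1 := h.relation_contract_right hr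
  have h2 := h.relation_contract_left hr
  have h4 := h.relation_mul_left hC hr
  have hc : c = 0 := by
    apply (mul_eq_zero.1 (?_ : c * (τ ^ 2 - τ - 1) = 0)).resolve_right hτ
    linear_combination h4 - h1 + h2 * (τ - 1)
  subst hc
  have hd : d = 0 := by linear_combination h2
  subst hd
  refine ⟨(mul_eq_zero.1 (?_ : a * κ = 0)).resolve_right hκ, rfl, rfl⟩
  linear_combination h4

/-- Here each rebracketing changes the sign, up to form terms. The pentagon of bracketings of four
factors has five edges, an odd number, so a fourfold product equals its own opposite up to lower
terms. Contracting the result produces a second trilinear relation, incompatible with p ≠ 0. -/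
lemma not_anti_relation [Nontrivial V] {p : ℂ} (h : IsTrivalent t C e f 1 κ κ' ν τ)
    (hC : C ≠ 0) (hκ : κ ≠ 0) (hτ : τ ^ 2 - τ - 1 ≠ 0) (hp : p ≠ 0)
    (hr : TrilinearRelation t C (-1) (-1) p p) : False := by
  have hX : ∀ u v w, C (C u v) w = p • t u v • w + p • t v w • u - C u (C v w) := by
    intro u v w
    linear_combination (norm := module) -hr u v w
  have hrot : ∀ u v w, t (C u v) w = t u (C v w) := fun u v w => by rw [h.rotate, one_mul]
  have key : ∀ u v w z, C u (C v (C w z)) - (p * t u v) • C w z - (p * t v w) • C u z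
      + (p * t u (C v w)) • z = 0 := by
    intro u v w z
    have e1 := hX (C u v) w z
    have e2 := hX u v (C w z)
    have e3 := congrArg (fun y => C y z) (hX u v w)
    have e4 := hX u (C v w) z
    have e5 := congrArg (fun y => C u y) (hX v w z)
    simp only [map_add, map_sub, map_smul, LinearMap.add_apply, LinearMap.sub_apply,
      LinearMap.smul_apply] at e3 e5
    rw [hrot] at e1 e4
    -- Going once around the pentagon gives twice the claimed identity.
    apply (smul_eq_zero_iff_right (two_ne_zero (α := ℂ))).1
    linear_combination (norm := module) e3 - e1 + e2 - e4 + e5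
  -- Insert the dual tensor into `key`, multiplying its first leg by v on the left: the fourfold
  -- product contracts to ν C(u, C(v, z)).
  have hr' : TrilinearRelation t C (-p) ν (p * κ) 0 := by
    intro u v z
    have h1 := Finset.sum_congr (rfl : Finset.univ = Finset.univ)
      fun i _ => key u (C v (e i)) (f i) z
    have h2 : ∑ i, (p * t u (C v (e i))) • C (f i) z = p • C (C u v) z := by
      conv_rhs => rw [← h.sum_right (C u v)]
      simp [Finset.smul_sum, smul_smul, hrot]
    simp only [Finset.sum_add_distrib, Finset.sum_sub_distrib, ← Finset.sum_smul, ← Finset.mul_sum,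
      h.sum_form_left, ← map_sum, h.sum_mul_right, h.sum_mul_mul, h2, Finset.sum_const_zero,
      map_smul] at h1
    simp only [smul_eq_mul] at h1
    linear_combination (norm := module) h1
  have hs : TrilinearRelation t C (-p - ν) 0 (p * κ + ν * p) (ν * p) := by
    intro u v w
    linear_combination (norm := module) hr' u v w + ν • hr u v w
  obtain ⟨h1, -, h3⟩ := h.relation_eq_zero hC hκ hτ hs
  have hν : ν = 0 := (mul_eq_zero.1 h3).resolve_right hp
  apply hp
  linear_combination -h1 - hν

/-- Normalize b = -1, so that the coefficients are (x, -1, p, q). Comparison with the rotated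
relation gives x²ω = 1, q = -xω²p and p = -xω²q, whence ω³ = 1. The contractions then leave ω = 1
and x = ±1, and x = -1 is the case of `not_anti_relation`. -/
theorem exists_relation [Nontrivial V] (h : IsTrivalent t C e f ω κ κ' ν τ) (hC : C ≠ 0)
    (hκ : κ ≠ 0) (hτ : τ ^ 2 - τ - 1 ≠ 0) (hτ0 : τ ≠ 0) (hτ2 : τ ≠ 2)
    (hr : TrilinearRelation t C a b c d) (hne : ¬ (a = 0 ∧ b = 0 ∧ c = 0 ∧ d = 0)) :
    ω = 1 ∧ ∃ p, κ = p * (τ - 1) ∧ TrilinearRelation t C 1 (-1) p (-p) := by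
  have hb : b ≠ 0 := by
    rintro rfl
    obtain ⟨h1, h2, h3⟩ := h.relation_eq_zero hC hκ hτ hr
    exact hne ⟨h1, rfl, h2, h3⟩
  obtain ⟨x, p, q, hxr⟩ : ∃ x p q, TrilinearRelation t C x (-1) p q := by
    refine ⟨-b⁻¹ * a, -b⁻¹ * c, -b⁻¹ * d, fun u v w => ?_⟩
    have h1 := congrArg (fun y => (-b⁻¹) • y) (hr u v w)
    simp only [smul_add, smul_zero] at h1
    rwa [smul_smul, smul_smul _ b, smul_smul, smul_smul _ d, neg_mul _ b, inv_mul_cancel₀ hb] at h1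
  have hω := h.omega_ne_zero hC
  have hrot := h.relation_rotate hxr
  -- Adding xω² times the relation to its rotation cancels the b-terms.
  have hs : TrilinearRelation t C (x ^ 2 * ω ^ 2 - ω) 0 (q + x * ω ^ 2 * p)
      (p + x * ω ^ 2 * q) := by
    intro u v w
    linear_combination (norm := module) hrot u v w + (x * ω ^ 2) • hxr u v w
  obtain ⟨r1, r2, r3⟩ := h.relation_eq_zero hC hκ hτ hs
  have c1 := h.relation_contract_right hxr
  have c2 := h.relation_contract_left hxr
  have c3 := h.relation_mul_right hC hxr
  have c4 := h.relation_mul_left hC hxr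
  have c5 := h.kappa_eq
  have hx : x ^ 2 * ω = 1 := by
    apply mul_left_cancel₀ hω
    linear_combination r1
  have hx0 : x ≠ 0 := by
    rintro rfl
    simp at hx
  have hp : p ≠ 0 := by
    rintro rfl
    have hq : q = 0 := by linear_combination r2
    subst hq
    apply mul_ne_zero hx0 hκ
    linear_combination c1
  have hω3 : ω ^ 3 = 1 := by
    apply mul_left_cancel₀ hp
    linear_combination -r3 + x * ω ^ 2 * r2 - p * ω ^ 3 * hx
  have hκ' : κ' = ω * κ := by
    linear_combination -ω * c5 - κ' * hω3
  have hx2 : x ^ 2 = ω ^ 2 := by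
    linear_combination ω ^ 2 * hx - x ^ 2 * hω3
  -- Eliminate ν between the two contractions that involve it.
  have hprod : (ω * κ - p) * (1 - ω) = 0 := by
    linear_combination -(c3 + x * c4) - hκ' + κ * hx2 + x * r2 - ω * p * hx
  rcases mul_eq_zero.1 hprod with h1 | h1
  -- If p = ωκ, the left contraction gives τ - 1 = xω², whose square is 1, so τ is 0 or 2.
  · exfalso
    have h2 : p * (τ - 1 - x * ω ^ 2) = 0 := by
      linear_combination c2 + hκ' + h1 - r2
    have h3 := (mul_eq_zero.1 h2).resolve_left hp
    have h4 : (x * ω ^ 2) ^ 2 = 1 := by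
      linear_combination ω ^ 3 * hx + hω3
    rcases sq_eq_one_iff.1 h4 with h5 | h5
    · exact hτ2 (by linear_combination h3 + h5)
    · exact hτ0 (by linear_combination h3 + h5)
  · obtain rfl : ω = 1 := by linear_combination -h1
    have hx1 : x ^ 2 = 1 := by linear_combination hx
    rcases sq_eq_one_iff.1 hx1 with rfl | rfl
    · obtain rfl : q = -p := by linear_combination r2
      exact ⟨rfl, p, by linear_combination c1, hxr⟩
    · obtain rfl : q = p := by linear_combination r2
      exact (h.not_anti_relation hC hκ hτ hp hxr).elim

end IsTrivalent

end Trivalent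

/-! ### Coefficient matrices and unitary bases -/

section UnitaryBasis

variable {H : Type*} [Ring H] [HopfAlgebra ℂ H]
variable {V : Type*} [AddCommGroup V] [Module ℂ V] {n : ℕ}

/-- The `i`-th coordinate in `H` of an element of `V ⊗ H`, with respect to a basis of `V`. -/
def tensorCoord (b : Module.Basis (Fin n) ℂ V) (i : Fin n) : V ⊗[ℂ] H →ₗ[ℂ] H :=
  (TensorProduct.lid ℂ H).toLinearMap ∘ₗ (b.coord i).rTensor H

lemma tensorCoord_tmul (b : Module.Basis (Fin n) ℂ V) (i : Fin n) (v : V) (h : H) :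
    tensorCoord b i (v ⊗ₜ[ℂ] h) = b.repr v i • h := by
  simp [tensorCoord]

lemma sum_tmul_tensorCoord (b : Module.Basis (Fin n) ℂ V) (y : V ⊗[ℂ] H) :
    ∑ i, b i ⊗ₜ[ℂ] tensorCoord b i y = y := by
  induction y with
  | zero => simp
  | add x y hx hy =>
    simp only [map_add, TensorProduct.tmul_add, Finset.sum_add_distrib, hx, hy]
  | tmul v h =>
    simp_rw [tensorCoord_tmul, ← TensorProduct.smul_tmul, ← TensorProduct.sum_tmul, b.sum_repr]

lemma tensorCoord_sum (b : Module.Basis (Fin n) ℂ V) (y : Fin n → H) (i : Fin n) :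
    tensorCoord b i (∑ j, b j ⊗ₜ[ℂ] y j) = y i := by
  simp [map_sum, tensorCoord_tmul, Finsupp.single_apply]

/-- `x` is the matrix of coefficients of `ρ` in the basis `b`. -/
def IsCoeffMatrix (ρ : Coaction H V) (b : Module.Basis (Fin n) ℂ V)
    (x : Matrix (Fin n) (Fin n) H) : Prop :=
  ∀ j, ρ.toLin (b j) = ∑ i, b i ⊗ₜ[ℂ] x i j

lemma exists_isCoeffMatrix (ρ : Coaction H V) (b : Module.Basis (Fin n) ℂ V) :
    ∃ x, IsCoeffMatrix ρ b x :=
  ⟨fun i j => tensorCoord b i (ρ.toLin (b j)), fun _ => (sum_tmul_tensorCoord b _).symm⟩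

lemma IsCoeffMatrix.isMultiplicativeMatrix {ρ : Coaction H V} {b : Module.Basis (Fin n) ℂ V}
    {x : Matrix (Fin n) (Fin n) H} (hx : IsCoeffMatrix ρ b x) : IsMultiplicativeMatrix x := by
  intro k j
  constructor
  · have h := LinearMap.congr_fun ρ.coassoc (b j)
    simp only [LinearMap.comp_apply, LinearEquiv.coe_coe, hx j, map_sum, LinearMap.rTensor_tmul,
      LinearMap.lTensor_tmul, hx _, TensorProduct.sum_tmul, TensorProduct.assoc_tmul] at h
    rw [Finset.sum_comm] at h
    simp_rw [← TensorProduct.tmul_sum] at h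
    have h2 := congrArg (tensorCoord b k) h
    rw [tensorCoord_sum, tensorCoord_sum] at h2
    exact h2.symm
  · have h := LinearMap.congr_fun ρ.counit_comp (b j)
    simp only [LinearMap.comp_apply, LinearEquiv.coe_coe, hx j, map_sum,
      LinearMap.lTensor_tmul, TensorProduct.rid_tmul, LinearMap.id_apply] at h
    have h2 := congrArg (fun v => b.repr v k) h
    simpa [Finsupp.single_apply, eq_comm] using h2

/-- The new basis vectors are the columns of K⁻¹ in the old basis, so conjugating the matrix is a
change of basis and unitarizability yields a basis rather than a new comodule. -/
lemma IsCoeffMatrix.conj {ρ : Coaction H V} {b : Module.Basis (Fin n) ℂ V}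
    {x : Matrix (Fin n) (Fin n) H} (hx : IsCoeffMatrix ρ b x) (K : GL (Fin n) ℂ) :
    ∃ b' : Module.Basis (Fin n) ℂ V, IsCoeffMatrix ρ b'
      ((K : Matrix (Fin n) (Fin n) ℂ).map (algebraMap ℂ H) * x *
        ((K⁻¹ : GL (Fin n) ℂ) : Matrix (Fin n) (Fin n) ℂ).map (algebraMap ℂ H)) := by
  set L : Matrix (Fin n) (Fin n) ℂ := ((K⁻¹ : GL (Fin n) ℂ) : Matrix (Fin n) (Fin n) ℂ) with hL
  have hdet : IsUnit L.det := Matrix.isUnits_det_units _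
  have hLK : L.map (algebraMap ℂ H) * (K : Matrix (Fin n) (Fin n) ℂ).map (algebraMap ℂ H) = 1 := by
    rw [← Matrix.map_mul, hL, Units.inv_mul, Matrix.map_one _ (map_zero _) (map_one _)]
  refine ⟨b.map (Matrix.toLinearEquiv b L hdet), fun j => ?_⟩
  have hb : ∀ j, (b.map (Matrix.toLinearEquiv b L hdet)) j = ∑ i, L i j • b i := fun j => by
    simp [Matrix.toLinearEquiv, Matrix.toLin_self]
  have h1 : ∀ y : Fin n → H, ∑ i, (b.map (Matrix.toLinearEquiv b L hdet)) i ⊗ₜ[ℂ] y i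
      = ∑ k, b k ⊗ₜ[ℂ] (L.map (algebraMap ℂ H)).mulVec y k := fun y => by
    simp_rw [hb, TensorProduct.sum_tmul, TensorProduct.smul_tmul, Matrix.mulVec, dotProduct,
      TensorProduct.tmul_sum]
    rw [Finset.sum_comm]
    simp [Algebra.smul_def]
  rw [h1 (fun i => (_ * x * _ : Matrix _ _ _) i j)]
  have h2 : (L.map (algebraMap ℂ H)).mulVec (fun i =>
      ((K : Matrix (Fin n) (Fin n) ℂ).map (algebraMap ℂ H) * x * L.map (algebraMap ℂ H)) i j)
      = fun k => (x * L.map (algebraMap ℂ H)) k j := by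
    funext k
    change (L.map (algebraMap ℂ H) * ((K : Matrix (Fin n) (Fin n) ℂ).map (algebraMap ℂ H) * x *
      L.map (algebraMap ℂ H))) k j = _
    rw [Matrix.mul_assoc, ← Matrix.mul_assoc, hLK, Matrix.one_mul]
  rw [h2, hb]
  simp_rw [map_sum, map_smul, hx _, Matrix.mul_apply, TensorProduct.tmul_sum, Finset.smul_sum]
  rw [Finset.sum_comm]
  refine Finset.sum_congr rfl fun k _ => Finset.sum_congr rfl fun i _ => ?_
  rw [Matrix.map_apply, ← Algebra.commutes, ← Algebra.smul_def, TensorProduct.tmul_smul]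

lemma IsCompactHopfAlgebra.exists_unitary_basis [StarRing H] [StarModule ℂ H]
    (hH : IsCompactHopfAlgebra H) [FiniteDimensional ℂ V] (ρ : Coaction H V) :
    ∃ (b : Module.Basis (Fin (Module.finrank ℂ V)) ℂ V) (x : Matrix _ _ H),
      IsCoeffMatrix ρ b x ∧ x ∈ unitary (Matrix _ _ H) := by
  obtain ⟨x, hx⟩ := exists_isCoeffMatrix ρ (Module.finBasis ℂ V)
  obtain ⟨K, hK⟩ := hH.unitarizable _ x hx.isMultiplicativeMatrix
  obtain ⟨b, hb⟩ := hx.conj K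
  exact ⟨b, _, hb, hK⟩

end UnitaryBasis

/-! ### Consequences of the fusion rules -/

section Fusion

variable {H : Type u} [Ring H] [HopfAlgebra ℂ H]
  {W : ℕ → Type v} [∀ n, AddCommGroup (W n)] [∀ n, Module ℂ (W n)] {ρ : ∀ n, Coaction H (W n)}

lemma LinearMap.prod_prod_apply {P Q R V : Type*} [AddCommGroup P] [Module ℂ P] [AddCommGroup Q]
    [Module ℂ Q] [AddCommGroup R] [Module ℂ R] [AddCommGroup V] [Module ℂ V]
    (f : P × (Q × R) →ₗ[ℂ] V) (x : P × (Q × R)) :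
    f x = f (LinearMap.inl ℂ P (Q × R) x.1) + f (LinearMap.inr ℂ P (Q × R)
      (LinearMap.inl ℂ Q R x.2.1)) + f (LinearMap.inr ℂ P (Q × R) (LinearMap.inr ℂ Q R x.2.2)) := by
  rw [← map_add, ← map_add]
  congr 1
  ext <;> simp

namespace HasSO3Fusion

lemma colinear_eq_zero (hW : HasSO3Fusion ρ) {m n : ℕ} (hmn : m ≠ n) {f : W m →ₗ[ℂ] W n}
    (hf : IsColinear (ρ m) (ρ n) f) : f = 0 :=
  hf.eq_zero_of_not_iso (hW.simple m) (hW.simple n) (hW.not_iso m n hmn)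

lemma exists_smul_id (hW : HasSO3Fusion ρ) {n : ℕ} {f : W n →ₗ[ℂ] W n}
    (hf : IsColinear (ρ n) (ρ n) f) : ∃ c : ℂ, f = c • LinearMap.id :=
  have := hW.finite n
  hf.exists_eq_smul_id (hW.simple n)

lemma invariant_eq_zero (hW : HasSO3Fusion ρ) {f : ℂ →ₗ[ℂ] W 1}
    (hf : IsColinear (trivialCoaction H) (ρ 1) f) : f = 0 := by
  obtain ⟨e, he⟩ := hW.zero
  have h := hW.colinear_eq_zero zero_ne_one (hf.comp he)
  ext
  obtain ⟨w, hw⟩ := e.surjective 1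
  rw [← hw]
  exact LinearMap.congr_fun h w

/-- W₁ occurs exactly once in W₁ ⊗ W₁ ≃ W₀ ⊕ W₁ ⊕ W₂. Take for `C` the projection on it; Schur kills
any other colinear map on the outer summands and makes it scalar on the middle one. -/
lemma exists_product (hW : HasSO3Fusion ρ) : ∃ C : W 1 ⊗[ℂ] W 1 →ₗ[ℂ] W 1, C ≠ 0 ∧
    IsColinear ((ρ 1).tensor (ρ 1)) (ρ 1) C ∧
    ∀ f, IsColinear ((ρ 1).tensor (ρ 1)) (ρ 1) f → ∃ c : ℂ, f = c • C := by
  obtain ⟨e, he⟩ := hW.fusion_right 0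
  refine ⟨LinearMap.fst ℂ _ _ ∘ₗ LinearMap.snd ℂ _ _ ∘ₗ e.toLinearMap, ?_, ?_, ?_⟩
  · intro h
    have := (hW.simple 1).1
    obtain ⟨v, hv⟩ := exists_ne (0 : W 1)
    apply hv
    simpa using LinearMap.congr_fun h (e.symm (0, (v, 0)))
  · exact (IsColinear.fst _ _).comp ((IsColinear.snd _ _).comp he)
  · intro f hf
    have hf' := hf.comp he.symm
    have h0 := hW.colinear_eq_zero (by decide) (hf'.comp (IsColinear.inl _ _))
    have h2 := hW.colinear_eq_zero (by decide)
      (hf'.comp ((IsColinear.inr _ _).comp (IsColinear.inr _ _)))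
    obtain ⟨c, hc⟩ := hW.exists_smul_id
      (hf'.comp ((IsColinear.inr _ _).comp (IsColinear.inl _ _)))
    refine ⟨c, LinearMap.ext fun x => ?_⟩
    have h := LinearMap.prod_prod_apply (f ∘ₗ e.symm.toLinearMap) (e x)
    have e0 := LinearMap.congr_fun h0 (e x).1
    have e1 := LinearMap.congr_fun hc (e x).2.1
    have e2 := LinearMap.congr_fun h2 (e x).2.2
    simp only [LinearMap.comp_apply, LinearEquiv.coe_coe, LinearEquiv.symm_apply_apply,
      LinearMap.zero_apply, LinearMap.smul_apply, LinearMap.id_apply] at h e0 e1 e2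
    rw [h, e0, e1, e2]
    simp

lemma exists_form (hW : HasSO3Fusion ρ) : ∃ t : W 1 ⊗[ℂ] W 1 →ₗ[ℂ] ℂ, t ≠ 0 ∧
    IsColinear ((ρ 1).tensor (ρ 1)) (trivialCoaction H) t := by
  obtain ⟨e, he⟩ := hW.fusion_right 0
  obtain ⟨e₀, he₀⟩ := hW.zero
  refine ⟨e₀.toLinearMap ∘ₗ LinearMap.fst ℂ _ _ ∘ₗ e.toLinearMap, ?_,
    he₀.comp ((IsColinear.fst _ _).comp he)⟩
  intro h
  simpa using LinearMap.congr_fun h (e.symm (e₀.symm 1, 0))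

/-- W₁ ⊗ W₁ ⊗ W₁ splits as (W₀ ⊕ W₁ ⊕ W₂) ⊗ W₁, and each of the three pieces contains W₁ exactly
once. -/
lemma exists_spanning_trilinear (hW : HasSO3Fusion ρ) :
    ∃ g : Fin 3 → ((W 1 ⊗[ℂ] W 1) ⊗[ℂ] W 1 →ₗ[ℂ] W 1),
      ∀ f, IsColinear (((ρ 1).tensor (ρ 1)).tensor (ρ 1)) (ρ 1) f →
        f ∈ Submodule.span ℂ (Set.range g) := by
  obtain ⟨e, he⟩ := hW.fusion_right 0
  obtain ⟨e', he'⟩ := hW.fusion_right 1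
  obtain ⟨e₀, he₀⟩ := hW.zero
  obtain ⟨C, -, -, hC⟩ := hW.exists_product
  let g₀ : W 0 ⊗[ℂ] W 1 →ₗ[ℂ] W 1 :=
    (TensorProduct.lid ℂ (W 1)).toLinearMap ∘ₗ TensorProduct.map e₀.toLinearMap LinearMap.id
  let g₂ : W 2 ⊗[ℂ] W 1 →ₗ[ℂ] W 1 := LinearMap.fst ℂ _ _ ∘ₗ e'.toLinearMap
  refine ⟨![g₀ ∘ₗ TensorProduct.map (LinearMap.fst ℂ _ _ ∘ₗ e.toLinearMap) LinearMap.id,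
    C ∘ₗ TensorProduct.map (LinearMap.fst ℂ _ _ ∘ₗ LinearMap.snd ℂ _ _ ∘ₗ e.toLinearMap)
      LinearMap.id,
    g₂ ∘ₗ TensorProduct.map (LinearMap.snd ℂ _ _ ∘ₗ LinearMap.snd ℂ _ _ ∘ₗ e.toLinearMap)
      LinearMap.id], fun f hf => ?_⟩
  have key : ∀ {m : ℕ} {i : W m →ₗ[ℂ] W 1 ⊗[ℂ] W 1}, IsColinear (ρ m) ((ρ 1).tensor (ρ 1)) i →
      IsColinear ((ρ m).tensor (ρ 1)) (ρ 1) (f ∘ₗ TensorProduct.map i LinearMap.id) :=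
    fun hi => hf.comp (hi.map (IsColinear.id _))
  have k₀ := key (he.symm.comp (IsColinear.inl _ _))
  have k₁ := key (he.symm.comp ((IsColinear.inr _ _).comp (IsColinear.inl _ _)))
  have k₂ := key (he.symm.comp ((IsColinear.inr _ _).comp (IsColinear.inr _ _)))
  obtain ⟨c₁, hc₁⟩ := hC _ k₁
  -- The first piece is treated through W₀ ⊗ W₁ ≃ ℂ ⊗ W₁ ≃ W₁.
  obtain ⟨c₀, hc₀⟩ := hW.exists_smul_id
    ((k₀.comp (he₀.symm.map (IsColinear.id _))).comp (IsColinear.symm (IsColinear.lid (ρ 1))))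
  have k₂' := k₂.comp he'.symm
  obtain ⟨c₂, hc₂⟩ := hW.exists_smul_id (k₂'.comp (IsColinear.inl _ _))
  have z₁ := hW.colinear_eq_zero (by decide)
    (k₂'.comp ((IsColinear.inr _ _).comp (IsColinear.inl _ _)))
  have z₂ := hW.colinear_eq_zero (by decide)
    (k₂'.comp ((IsColinear.inr _ _).comp (IsColinear.inr _ _)))
  have hf_eq : f = c₀ • (g₀ ∘ₗ TensorProduct.map (LinearMap.fst ℂ _ _ ∘ₗ e.toLinearMap)
        LinearMap.id)
      + c₁ • (C ∘ₗ TensorProduct.map (LinearMap.fst ℂ _ _ ∘ₗ LinearMap.snd ℂ _ _ ∘ₗ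
        e.toLinearMap) LinearMap.id)
      + c₂ • (g₂ ∘ₗ TensorProduct.map (LinearMap.snd ℂ _ _ ∘ₗ LinearMap.snd ℂ _ _ ∘ₗ
        e.toLinearMap) LinearMap.id) := by
    refine TensorProduct.ext' fun x w => ?_
    have h := LinearMap.prod_prod_apply (LinearMap.id (R := ℂ)) (e x)
    have h' := congrArg (fun y => f (e.symm y ⊗ₜ w)) h
    simp only [LinearMap.id_apply, LinearEquiv.symm_apply_apply, map_add,
      TensorProduct.add_tmul] at h'
    rw [h']
    have e0 := LinearMap.congr_fun hc₀ (e₀ (e x).1 • w)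
    have e1 := LinearMap.congr_fun hc₁ ((e x).2.1 ⊗ₜ w)
    have e2 := LinearMap.prod_prod_apply ((f ∘ₗ TensorProduct.map (e.symm.toLinearMap ∘ₗ
      LinearMap.inr ℂ (W 0) (W 1 × W 2) ∘ₗ LinearMap.inr ℂ (W 1) (W 2)) LinearMap.id) ∘ₗ
      e'.symm.toLinearMap) (e' ((e x).2.2 ⊗ₜ w))
    have e3 := LinearMap.congr_fun hc₂ (e' ((e x).2.2 ⊗ₜ w)).1
    have e4 := LinearMap.congr_fun z₁ (e' ((e x).2.2 ⊗ₜ w)).2.1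
    have e5 := LinearMap.congr_fun z₂ (e' ((e x).2.2 ⊗ₜ w)).2.2
    simp only [LinearMap.comp_apply] at e3 e4 e5
    simp only [LinearMap.comp_apply] at e2
    rw [e3, e4, e5] at e2
    simp only [LinearMap.comp_apply, LinearEquiv.coe_coe, LinearEquiv.symm_apply_apply,
      LinearMap.zero_apply, LinearMap.smul_apply, LinearMap.id_apply, TensorProduct.map_tmul,
      TensorProduct.lid_symm_apply, add_zero] at e0 e1 e2
    rw [e1, e2]
    congr 2
    rw [← TensorProduct.smul_tmul] at e0
    rw [← map_smul, ← map_smul, ← map_smul, smul_eq_mul, mul_one, LinearEquiv.symm_apply_apply] at e0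
    exact e0
  rw [hf_eq]
  refine add_mem (add_mem ?_ ?_) ?_ <;> refine Submodule.smul_mem _ _ (Submodule.subset_span ?_)
  · exact ⟨0, rfl⟩
  · exact ⟨1, rfl⟩
  · exact ⟨2, rfl⟩

lemma exists_trilinear_relation (hW : HasSO3Fusion ρ)
    (F : Fin 4 → ((W 1 ⊗[ℂ] W 1) ⊗[ℂ] W 1 →ₗ[ℂ] W 1))
    (hF : ∀ i, IsColinear (((ρ 1).tensor (ρ 1)).tensor (ρ 1)) (ρ 1) (F i)) :
    ∃ c : Fin 4 → ℂ, ∑ i, c i • F i = 0 ∧ c ≠ 0 := by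
  obtain ⟨g, hg⟩ := hW.exists_spanning_trilinear
  have hdep : ¬ LinearIndependent ℂ F := by
    intro h
    have h1 := finrank_span_eq_card h
    have h2 : Submodule.span ℂ (Set.range F) ≤ Submodule.span ℂ (Set.range g) := by
      rw [Submodule.span_le]
      rintro _ ⟨i, rfl⟩
      exact hg _ (hF i)
    have := FiniteDimensional.span_of_finite ℂ (Set.finite_range g)
    have h3 := Submodule.finrank_mono h2
    have h4 := finrank_range_le_card (R := ℂ) g
    rw [Set.finrank] at h4
    simp only [Fintype.card_fin] at h1 h4
    omega
  obtain ⟨c, hc, i, hi⟩ := Fintype.not_linearIndependent_iff.1 hdep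
  exact ⟨c, hc, fun h => hi (by rw [h]; rfl)⟩

/-- Count dimensions with d = dim W₁: d² = 1 + d + dim W₂ excludes d = 1, and d = 2 would give dim
W₂ = 1, too small for W₂ ⊗ W₁ to contain W₁ ⊕ W₂. -/
lemma three_le_finrank (hW : HasSO3Fusion ρ) : 3 ≤ Module.finrank ℂ (W 1) := by
  have := hW.finite
  have := (hW.simple 1).1
  obtain ⟨e, -⟩ := hW.fusion_right 0
  obtain ⟨e', -⟩ := hW.fusion_right 1
  obtain ⟨e₀, -⟩ := hW.zero
  have h1 := e.finrank_eq
  have h2 := e'.finrank_eq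
  have h0 := e₀.finrank_eq
  simp only [Module.finrank_tensorProduct, Module.finrank_prod, Module.finrank_self,
    Nat.reduceAdd] at h0 h1 h2
  have hpos : 0 < Module.finrank ℂ (W 1) := Module.finrank_pos
  rw [h0] at h1
  generalize Module.finrank ℂ (W 1) = d at *
  by_contra hlt
  interval_cases d <;> omega

end HasSO3Fusion

end Fusion

/-! ### The antilinear involution attached to an invariant form -/

lemma sum_mul_star_of_mem_unitary {H : Type*} [Ring H] [StarRing H] {n : ℕ}
    {x : Matrix (Fin n) (Fin n) H}
    (hx : x ∈ unitary (Matrix (Fin n) (Fin n) H)) (i j : Fin n) :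
    ∑ m, x i m * star (x j m) = if i = j then 1 else 0 := by
  have h := congrArg (fun M : Matrix (Fin n) (Fin n) H => M i j) (Unitary.mul_star_self_of_mem hx)
  simp only [Matrix.star_eq_conjTranspose, Matrix.mul_apply, Matrix.one_apply] at h
  exact h

/-- Multiply the invariance identity of `t` on the right by `star (x k m)`, sum over m, and cancel
one factor by unitarity. The form thus intertwines `x` with its entrywise adjoint. -/
lemma IsCoeffMatrix.sum_form_smul {H : Type*} [Ring H] [HopfAlgebra ℂ H] [StarRing H]
    {V : Type*} [AddCommGroup V] [Module ℂ V] {n : ℕ} {ρ : Coaction H V}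
    {b : Module.Basis (Fin n) ℂ V} {x : Matrix (Fin n) (Fin n) H} {t : V ⊗[ℂ] V →ₗ[ℂ] ℂ}
    (hb : IsCoeffMatrix ρ b x)
    (hx : x ∈ unitary (Matrix (Fin n) (Fin n) H))
    (ht : IsColinear (ρ.tensor ρ) (trivialCoaction H) t) (j k : Fin n) :
    ∑ i, t (b i ⊗ₜ b k) • x i j = ∑ m, t (b j ⊗ₜ b m) • star (x k m) := by
  have h : ∀ m, t (b j ⊗ₜ b m) • (1 : H) =
      ∑ i, ∑ l, t (b i ⊗ₜ b l) • (x i j * x l m) := fun m => by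
    have h1 := congrArg (TensorProduct.lid ℂ H) (ht.apply (b j ⊗ₜ b m))
    rw [Coaction.tensor_tmul, hb, hb] at h1
    rw [Finset.sum_comm]
    simpa [trivialCoaction, TensorProduct.sum_tmul, TensorProduct.tmul_sum] using h1
  have h2 : ∀ m, t (b j ⊗ₜ b m) • star (x k m) =
      ∑ i, ∑ l, t (b i ⊗ₜ b l) • (x i j * (x l m * star (x k m))) := fun m => by
    rw [← one_mul (star (x k m)), ← smul_mul_assoc, h m]
    simp [Finset.sum_mul, mul_assoc]
  simp_rw [h2]
  rw [Finset.sum_comm]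
  refine Finset.sum_congr rfl fun i _ => ?_
  rw [Finset.sum_comm]
  simp_rw [← Finset.smul_sum, ← Finset.mul_sum, sum_mul_star_of_mem_unitary hx]
  simp

section Antilinear

open scoped ComplexConjugate

variable {H : Type*} [Ring H] [HopfAlgebra ℂ H] [StarRing H]
variable {V : Type*} [AddCommGroup V] [Module ℂ V] {n : ℕ}

/-- The antilinear map representing a bilinear form through the inner product for which `b` is
orthonormal. -/
def antilinearOfForm (b : Module.Basis (Fin n) ℂ V) (t : V ⊗[ℂ] V →ₗ[ℂ] ℂ) : V →ₗ⋆[ℂ] V where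
  toFun u := ∑ i, conj (t (u ⊗ₜ b i)) • b i
  map_add' u v := by simp [TensorProduct.add_tmul, add_smul, Finset.sum_add_distrib]
  map_smul' c u := by
    simp [← TensorProduct.smul_tmul', mul_smul, Finset.smul_sum]

lemma antilinearOfForm_apply (b : Module.Basis (Fin n) ℂ V) (t : V ⊗[ℂ] V →ₗ[ℂ] ℂ) (u : V) :
    antilinearOfForm b t u = ∑ i, conj (t (u ⊗ₜ b i)) • b i := rfl

lemma form_eq_sum (b : Module.Basis (Fin n) ℂ V) (t : V ⊗[ℂ] V →ₗ[ℂ] ℂ) (u v : V) :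
    t (u ⊗ₜ v) = ∑ i, conj (b.repr (antilinearOfForm b t u) i) * b.repr v i := by
  conv_lhs => rw [← b.sum_repr v]
  simp only [TensorProduct.tmul_sum, map_sum, TensorProduct.tmul_smul, map_smul]
  simp [antilinearOfForm_apply, Finsupp.single_apply, mul_comm]

lemma antilinearOfForm_smul (b : Module.Basis (Fin n) ℂ V) (t : V ⊗[ℂ] V →ₗ[ℂ] ℂ) (a : ℂ) (u : V) :
    antilinearOfForm b (a • t) u = conj a • antilinearOfForm b t u := by
  simp [antilinearOfForm_apply, Finset.smul_sum, mul_smul]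

section Injective

variable {ρ : Coaction H V} {b : Module.Basis (Fin n) ℂ V} {x : Matrix (Fin n) (Fin n) H}
  {t : V ⊗[ℂ] V →ₗ[ℂ] ℂ}

/-- The linear map `G`, which is J without the complex conjugation of coordinates, intertwines `ρ`
with the conjugate coaction `T`. Its kernel is therefore a subcomodule, and it is not everything
because t ≠ 0. -/
lemma IsCoeffMatrix.antilinearOfForm_injective (hb : IsCoeffMatrix ρ b x)
    (hx : x ∈ unitary (Matrix (Fin n) (Fin n) H)) (hρ : IsSimpleComodule ρ)
    (ht : IsColinear (ρ.tensor ρ) (trivialCoaction H) t) (ht0 : t ≠ 0) :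
    Function.Injective (antilinearOfForm b t) := by
  let G : V →ₗ[ℂ] V := ∑ i, ((TensorProduct.curry t).flip (b i)).smulRight (b i)
  have hG : ∀ u, G u = ∑ i, t (u ⊗ₜ b i) • b i := fun u => by simp [G]
  let T : V →ₗ[ℂ] V ⊗[ℂ] H := b.constr ℂ fun m => ∑ k, b k ⊗ₜ[ℂ] star (x k m)
  have hT : ∀ m, T (b m) = ∑ k, b k ⊗ₜ[ℂ] star (x k m) := fun m => b.constr_basis ℂ _ m
  have hTG : T ∘ₗ G = G.rTensor H ∘ₗ ρ.toLin := by
    refine b.ext fun j => ?_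
    simp only [LinearMap.comp_apply, hb j, map_sum, LinearMap.rTensor_tmul, hG, map_smul, hT,
      Finset.smul_sum, TensorProduct.sum_tmul, TensorProduct.smul_tmul]
    conv_lhs => rw [Finset.sum_comm]
    conv_rhs => rw [Finset.sum_comm]
    refine Finset.sum_congr rfl fun k _ => ?_
    simp only [← TensorProduct.tmul_smul, ← TensorProduct.tmul_sum]
    rw [hb.sum_form_smul hx ht j k]
  have hrepr : ∀ u i, b.repr (antilinearOfForm b t u) i = conj (b.repr (G u) i) := fun u i => by
    simp [antilinearOfForm_apply, hG, Finsupp.single_apply]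
  rcases hρ.eq_zero_or_injective T G hTG with h | h
  · refine absurd (TensorProduct.ext' fun u v => ?_) ht0
    rw [form_eq_sum b]
    simp [hrepr, h]
  · rw [injective_iff_map_eq_zero]
    intro u hu
    apply h
    rw [map_zero]
    apply b.repr.injective
    ext i
    have := hrepr u i
    rw [hu] at this
    simpa using this.symm

end Injective

variable [StarModule ℂ H]

variable (H) in
/-- The antilinear map `J ⊗ *` on `V ⊗ H`. -/
def starTensor (J : V →ₗ⋆[ℂ] V) : V ⊗[ℂ] H →ₗ⋆[ℂ] V ⊗[ℂ] H :=
  TensorProduct.map J (starLinearEquiv ℂ (A := H)).toLinearMap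

@[simp] lemma starTensor_tmul (J : V →ₗ⋆[ℂ] V) (v : V) (h : H) :
    starTensor H J (v ⊗ₜ h) = J v ⊗ₜ star h := rfl

/-- An antilinear map `J` compatible with the coaction: `α(J v) = (J ⊗ *) α(v)`. -/
def IsAnticolinear (ρ : Coaction H V) (J : V →ₗ⋆[ℂ] V) : Prop :=
  ∀ v, ρ.toLin (J v) = starTensor H J (ρ.toLin v)

section Invariant

variable {ρ : Coaction H V} {b : Module.Basis (Fin n) ℂ V} {x : Matrix (Fin n) (Fin n) H}
  {t : V ⊗[ℂ] V →ₗ[ℂ] ℂ}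

lemma IsCoeffMatrix.isAnticolinear (hb : IsCoeffMatrix ρ b x)
    (hx : x ∈ unitary (Matrix (Fin n) (Fin n) H))
    (ht : IsColinear (ρ.tensor ρ) (trivialCoaction H) t) :
    IsAnticolinear ρ (antilinearOfForm b t) := by
  have h : ρ.toLin.comp (antilinearOfForm b t) =
      (starTensor H (antilinearOfForm b t)).comp ρ.toLin := by
    refine b.ext fun j => ?_
    simp only [LinearMap.comp_apply, hb j, map_sum, starTensor_tmul, antilinearOfForm_apply,
      map_smul, hb _, Finset.smul_sum, TensorProduct.sum_tmul, TensorProduct.smul_tmul]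
    conv_lhs => rw [Finset.sum_comm]
    conv_rhs => rw [Finset.sum_comm]
    refine Finset.sum_congr rfl fun k _ => ?_
    have h1 := congrArg star (hb.sum_form_smul hx ht j k)
    simp only [star_sum, star_smul, star_star] at h1
    simp only [← TensorProduct.tmul_smul, ← TensorProduct.tmul_sum]
    exact congrArg (b k ⊗ₜ[ℂ] ·) h1.symm
  exact fun v => LinearMap.congr_fun h v

end Invariant

lemma starTensor_starTensor (J : V →ₗ⋆[ℂ] V) (y : V ⊗[ℂ] H) :
    starTensor H J (starTensor H J y) =
      ((J.comp J : V →ₗ[ℂ] V)).rTensor H y := by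
  induction y with
  | zero => simp
  | add x y hx hy => simp only [map_add, hx, hy]
  | tmul v h => simp

/-- J² is linear and colinear, hence a scalar c by Schur; as J is antilinear and commutes with J², c
is real. -/
lemma IsAnticolinear.exists_sq_eq [FiniteDimensional ℂ V] {ρ : Coaction H V}
    (hρ : IsSimpleComodule ρ) {J : V →ₗ⋆[ℂ] V} (hJ : IsAnticolinear ρ J)
    (hinj : Function.Injective J) : ∃ c : ℝ, c ≠ 0 ∧ ∀ v, J (J v) = (c : ℂ) • v := by
  have := hρ.1
  have h : IsColinear ρ ρ (J.comp J : V →ₗ[ℂ] V) := by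
    refine LinearMap.ext fun v => ?_
    change ρ.toLin (J (J v)) = _
    rw [hJ, hJ, starTensor_starTensor]
    rfl
  obtain ⟨c, hc⟩ := h.exists_eq_smul_id hρ
  have hc' : ∀ v, J (J v) = c • v := fun v => LinearMap.congr_fun hc v
  obtain ⟨v, hv⟩ := exists_ne (0 : V)
  have hJv : J v ≠ 0 := fun h => hv (hinj (by rw [h, map_zero]))
  have hreal : conj c = c := by
    have h1 := hc' (J v)
    rw [hc' v, map_smulₛₗ] at h1
    exact smul_left_injective ℂ hJv h1
  obtain ⟨r, rfl⟩ := Complex.conj_eq_iff_real.1 hreal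
  refine ⟨r, ?_, hc'⟩
  rintro rfl
  apply hJv
  apply hinj
  rw [hc', map_zero]
  simp

/-- The conjugate `v ⊗ w ↦ J (C (J w ⊗ J v))` of a bilinear product. -/
def conjProduct (J : V →ₗ⋆[ℂ] V) (C : V ⊗[ℂ] V →ₗ[ℂ] V) : V ⊗[ℂ] V →ₗ[ℂ] V :=
  TensorProduct.lift (LinearMap.mk₂ ℂ (fun v w => J (C (J w ⊗ₜ J v)))
    (fun v v' w => by simp [TensorProduct.tmul_add])
    (fun c v w => by simp)
    (fun v w w' => by simp [TensorProduct.add_tmul])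
    (fun c v w => by simp [← TensorProduct.smul_tmul']))

@[simp] lemma conjProduct_tmul (J : V →ₗ⋆[ℂ] V) (C : V ⊗[ℂ] V →ₗ[ℂ] V) (v w : V) :
    conjProduct J C (v ⊗ₜ w) = J (C (J w ⊗ₜ J v)) := rfl

lemma IsAnticolinear.conjProduct {ρ : Coaction H V} {J : V →ₗ⋆[ℂ] V} (hJ : IsAnticolinear ρ J)
    {C : V ⊗[ℂ] V →ₗ[ℂ] V} (hC : IsColinear (ρ.tensor ρ) ρ C) :
    IsColinear (ρ.tensor ρ) ρ (conjProduct J C) := by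
  refine TensorProduct.ext' fun v w => ?_
  simp only [LinearMap.comp_apply, conjProduct_tmul, hJ _, hC.apply, Coaction.tensor_tmul]
  generalize ρ.toLin v = x
  generalize ρ.toLin w = y
  induction x with
  | zero => simp
  | add a b ha hb => simp only [map_add, TensorProduct.tmul_add, TensorProduct.add_tmul, ha, hb]
  | tmul v h =>
    induction y with
    | zero => simp
    | add a b ha hb => simp only [map_add, TensorProduct.tmul_add, TensorProduct.add_tmul, ha, hb]
    | tmul w k => simp

/-- If `J² = c` and `C` has conjugate `μ C`, then `c³ = |μ|²`. -/
lemma cube_eq_of_conjProduct {J : V →ₗ⋆[ℂ] V} {C : V ⊗[ℂ] V →ₗ[ℂ] V} (hC : C ≠ 0) {c : ℝ}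
    (hJ : ∀ v, J (J v) = (c : ℂ) • v) {μ : ℂ} (hμ : conjProduct J C = μ • C) :
    c ^ 3 = ‖μ‖ ^ 2 := by
  obtain ⟨v, w, hvw⟩ : ∃ v w, C (v ⊗ₜ w) ≠ 0 := by
    by_contra! h
    exact hC (TensorProduct.ext' h)
  have h : ∀ v w, J (C (J w ⊗ₜ J v)) = μ • C (v ⊗ₜ w) := fun v w =>
    LinearMap.congr_fun hμ (v ⊗ₜ w)
  -- Conjugating `C` twice gives c³C on one side, since J² = c acts on both arguments and on the
  -- value, and |μ|²C on the other.
  have h1 := congrArg J (h (J w) (J v))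
  simp only [hJ, map_smulₛₗ, h, TensorProduct.smul_tmul_smul, smul_smul,
    RingHom.map_mul, RingHom.id_apply, Complex.conj_ofReal] at h1
  have h2 := smul_left_injective ℂ hvw h1
  have h3 : ((c ^ 3 : ℝ) : ℂ) = ((‖μ‖ ^ 2 : ℝ) : ℂ) := by
    have := Complex.conj_mul' μ
    push_cast
    rw [← this]
    linear_combination h2
  exact_mod_cast h3

/-- An involutive antilinear map `J`, a form and a product on `V` compatible with it. -/
structure IsInvolutiveProduct (b : Module.Basis (Fin n) ℂ V) (J : V →ₗ⋆[ℂ] V)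
    (t : V ⊗[ℂ] V →ₗ[ℂ] ℂ) (C : V ⊗[ℂ] V →ₗ[ℂ] V) : Prop where
  invol : ∀ v, J (J v) = v
  form_eq : ∀ u v, t (u ⊗ₜ v) = ∑ i, conj (b.repr (J u) i) * b.repr v i
  map_mul : ∀ u v, J (C (u ⊗ₜ v)) = C (J v ⊗ₜ J u)

/-- The invariant product rules out the quaternionic case c < 0, because c³ = |μ|². Replacing t by
t/√c then makes J² = 1, and a phase corrects `C`. -/
theorem IsCoeffMatrix.exists_isInvolutiveProduct [FiniteDimensional ℂ V] {ρ : Coaction H V}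
    {b : Module.Basis (Fin n) ℂ V} {x : Matrix (Fin n) (Fin n) H} (hb : IsCoeffMatrix ρ b x)
    (hx : x ∈ unitary (Matrix (Fin n) (Fin n) H)) (hρ : IsSimpleComodule ρ)
    {t : V ⊗[ℂ] V →ₗ[ℂ] ℂ} (ht : IsColinear (ρ.tensor ρ) (trivialCoaction H) t) (ht0 : t ≠ 0)
    {C : V ⊗[ℂ] V →ₗ[ℂ] V} (hC : IsColinear (ρ.tensor ρ) ρ C) (hC0 : C ≠ 0)
    (huniq : ∀ f, IsColinear (ρ.tensor ρ) ρ f → ∃ c : ℂ, f = c • C) :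
    ∃ (J : V →ₗ⋆[ℂ] V) (a z : ℂ), IsAnticolinear ρ J ∧ z ≠ 0 ∧
      IsInvolutiveProduct b J (a • t) (z • C) := by
  obtain ⟨c, hc0, hc⟩ := (hb.isAnticolinear hx ht).exists_sq_eq hρ
    (hb.antilinearOfForm_injective hx hρ ht ht0)
  obtain ⟨μ, hμ⟩ := huniq _ ((hb.isAnticolinear hx ht).conjProduct hC)
  have hpos : 0 < c := by
    have h := cube_eq_of_conjProduct hC0 hc hμ
    have h1 : 0 ≤ c ^ 3 := h ▸ sq_nonneg _
    have h2 : 0 ≤ c := (Odd.pow_nonneg_iff (by decide)).1 h1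
    exact lt_of_le_of_ne h2 hc0.symm
  set a : ℂ := (((Real.sqrt c)⁻¹ : ℝ) : ℂ) with ha
  have hat : IsColinear (ρ.tensor ρ) (trivialCoaction H) (a • t) := ht.smul a
  set J := antilinearOfForm b (a • t) with hJdef
  have hJ : IsAnticolinear ρ J := hb.isAnticolinear hx hat
  have hJJ : ∀ v, J (J v) = v := fun v => by
    have haa : conj a = a := Complex.conj_ofReal _
    have hac : a * (a * c) = 1 := by
      rw [ha, ← Complex.ofReal_mul, ← Complex.ofReal_mul, ← Complex.ofReal_one]
      congr 1
      have hs : Real.sqrt c ≠ 0 := (Real.sqrt_pos.2 hpos).ne'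
      field_simp
      exact (Real.sq_sqrt hpos.le).symm
    rw [hJdef, antilinearOfForm_smul, antilinearOfForm_smul, map_smulₛₗ, hc, haa, haa, smul_smul,
      smul_smul, mul_assoc, hac, one_smul]
  obtain ⟨μ', hμ'⟩ := huniq _ (hJ.conjProduct hC)
  have hμ1 := cube_eq_of_conjProduct (c := 1) hC0 (by simpa using hJJ) hμ'
  have hnorm : ‖μ'‖ = 1 := by
    have := norm_nonneg μ'
    nlinarith
  -- With z² = μ' and |z| = 1 one has conj z · μ' = z, so `z • C` is compatible with J.
  obtain ⟨z, hz⟩ := IsAlgClosed.exists_pow_nat_eq μ' (n := 2) (by norm_num)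
  have hzn : ‖z‖ = 1 := by
    have h1 : ‖z‖ ^ 2 = 1 := by rw [← norm_pow, hz, hnorm]
    nlinarith [norm_nonneg z]
  have hzz : conj z * z = 1 := by rw [Complex.conj_mul', hzn]; simp
  refine ⟨J, a, z, hJ, ?_, hJJ, fun u v => form_eq_sum b (a • t) u v, fun u v => ?_⟩
  · rintro rfl
    simp at hzn
  · have h := LinearMap.congr_fun hμ' (J v ⊗ₜ J u)
    simp only [conjProduct_tmul, hJJ, LinearMap.smul_apply] at h ⊢
    rw [map_smulₛₗ, h, smul_smul, ← hz]
    congr 1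
    linear_combination z * hzz

end Antilinear

/-! ### Positivity and the normalization of the product -/

section InvolutiveProduct

open scoped ComplexConjugate

variable {V : Type*} [AddCommGroup V] [Module ℂ V] {n : ℕ} {b : Module.Basis (Fin n) ℂ V}
  {J : V →ₗ⋆[ℂ] V} {t : V ⊗[ℂ] V →ₗ[ℂ] ℂ} {C : V ⊗[ℂ] V →ₗ[ℂ] V}

/-- The tensor `∑ bᵢ ⊗ J bᵢ`. -/
def dualTensor (b : Module.Basis (Fin n) ℂ V) (J : V →ₗ⋆[ℂ] V) : V ⊗[ℂ] V :=
  ∑ i, b i ⊗ₜ J (b i)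

namespace IsInvolutiveProduct

lemma form_self (h : IsInvolutiveProduct b J t C) (y : V) :
    t (y ⊗ₜ J y) = ((∑ i, ‖b.repr (J y) i‖ ^ 2 : ℝ) : ℂ) := by
  rw [h.form_eq]
  push_cast
  exact Finset.sum_congr rfl fun i _ => Complex.conj_mul' _

lemma form_self_eq_zero (h : IsInvolutiveProduct b J t C) {y : V} (hy : t (y ⊗ₜ J y) = 0) :
    y = 0 := by
  rw [h.form_self, Complex.ofReal_eq_zero,
    Finset.sum_eq_zero_iff_of_nonneg fun i _ => sq_nonneg _] at hy
  have h1 : J y = 0 := by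
    apply b.repr.injective
    ext i
    simpa using hy i (Finset.mem_univ i)
  rw [← h.invol y, h1, map_zero]

lemma form_star (h : IsInvolutiveProduct b J t C) (u v : V) :
    t (J v ⊗ₜ J u) = conj (t (u ⊗ₜ v)) := by
  rw [h.form_eq, h.form_eq, h.invol, map_sum]
  exact Finset.sum_congr rfl fun i _ => by simp [mul_comm]

lemma sum_left (h : IsInvolutiveProduct b J t C) (u : V) :
    ∑ i, t (J (b i) ⊗ₜ u) • b i = u := by
  conv_rhs => rw [← b.sum_repr u]
  refine Finset.sum_congr rfl fun i _ => ?_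
  rw [h.form_eq, h.invol]
  simp [Finsupp.single_apply]

lemma sum_right (h : IsInvolutiveProduct b J t C) (u : V) :
    ∑ i, t (u ⊗ₜ b i) • J (b i) = u := by
  have h1 : ∀ i, t (u ⊗ₜ b i) = conj (b.repr (J u) i) := fun i => by
    rw [h.form_eq]
    simp [Finsupp.single_apply]
  simp_rw [h1, ← map_smulₛₗ, ← map_sum, b.sum_repr, h.invol]

/-- Let g be the matrix of J. The sum is the squared Hilbert–Schmidt norm of g, and J² = 1 says that
g times its entrywise conjugate is 1; taking traces and applying 2|xy| ≤ |x|² + |y|² bounds n by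
that norm. -/
lemma exists_le_sum_form (h : IsInvolutiveProduct b J t C) :
    ∃ τ : ℝ, n ≤ τ ∧ ∑ i, t (b i ⊗ₜ J (b i)) = τ := by
  refine ⟨∑ i, ∑ k, ‖b.repr (J (b i)) k‖ ^ 2, ?_, ?_⟩
  · set g : Fin n → Fin n → ℂ := fun k i => b.repr (J (b i)) k with hg
    have h1 : ∀ i, ∑ k, conj (g k i) * g i k = 1 := fun i => by
      have h2 : J (J (b i)) = ∑ k, conj (g k i) • J (b k) := by
        conv_lhs => rw [← b.sum_repr (J (b i))]
        simp only [map_sum, map_smulₛₗ, hg]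
      have h3 := congrArg (fun y => b.repr y i) h2
      simpa [h.invol, hg] using h3.symm
    have h2 : ∑ i : Fin n, ∑ k, (conj (g k i) * g i k).re = n := by
      simp_rw [← Complex.re_sum, h1]
      simp
    have h3 : ∀ i k, (conj (g k i) * g i k).re ≤ (‖g k i‖ ^ 2 + ‖g i k‖ ^ 2) / 2 := fun i k => by
      have h4 := Complex.re_le_norm (conj (g k i) * g i k)
      rw [norm_mul, RCLike.norm_conj] at h4
      nlinarith [sq_nonneg (‖g k i‖ - ‖g i k‖)]
    calc (n : ℝ) = ∑ i : Fin n, ∑ k, (conj (g k i) * g i k).re := h2.symm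
      _ ≤ ∑ i : Fin n, ∑ k, (‖g k i‖ ^ 2 + ‖g i k‖ ^ 2) / 2 :=
          Finset.sum_le_sum fun i _ => Finset.sum_le_sum fun k _ => h3 i k
      _ = (∑ i : Fin n, ∑ k, ‖g k i‖ ^ 2 + ∑ i : Fin n, ∑ k, ‖g i k‖ ^ 2) / 2 := by
          simp_rw [← Finset.sum_div, Finset.sum_add_distrib]
      _ = ∑ i, ∑ k, ‖g k i‖ ^ 2 := by
          rw [Finset.sum_comm (f := fun i k => ‖g i k‖ ^ 2)]
          ring
  · rw [Complex.ofReal_sum]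
    exact Finset.sum_congr rfl fun i _ => h.form_self _

/-- The contraction of `C` against the dual tensor acts by a positive multiple of the rotation
scalar. -/
lemma exists_kappa_eq (h : IsInvolutiveProduct b J t C) (hC : C ≠ 0) {ω κ κ' ν τ : ℂ}
    (ht : IsTrivalent (TensorProduct.curry t) (TensorProduct.curry C) b (J ∘ b) ω κ κ' ν τ) :
    ∃ r : ℝ, 0 < r ∧ κ = ω * r := by
  obtain ⟨u, i, hu⟩ : ∃ u i, C (u ⊗ₜ b i) ≠ 0 := by
    by_contra! h0
    refine hC (TensorProduct.ext (LinearMap.ext fun u => b.ext fun i => ?_))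
    simpa using h0 u i
  have h1 := congrArg (fun y => t (y ⊗ₜ J u)) (ht.sum_mul_right u)
  simp only [TensorProduct.curry_apply, TensorProduct.sum_tmul, map_sum, Function.comp_apply,
    ← TensorProduct.smul_tmul', map_smul, smul_eq_mul] at h1
  -- After one rotation the term is ω t(y, J y) with y = C(u, bⱼ), because J reverses products.
  -- Summing compares κ‖J u‖² with ω times a positive number.
  have h2 : ∀ j, t (C (C (u ⊗ₜ b j) ⊗ₜ J (b j)) ⊗ₜ J u) =
      ω * ((∑ i, ‖b.repr (J (C (u ⊗ₜ b j))) i‖ ^ 2 : ℝ) : ℂ) := fun j => by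
    have h3 := ht.rotate (C (u ⊗ₜ b j)) (J (b j)) (J u)
    simp only [TensorProduct.curry_apply] at h3
    rw [h3, ← h.map_mul, h.form_self]
  simp_rw [h2, ← Finset.mul_sum, ← Complex.ofReal_sum, h.form_self] at h1
  set S : ℝ := ∑ j, ∑ i, ‖b.repr (J (C (u ⊗ₜ b j))) i‖ ^ 2 with hS
  set N : ℝ := ∑ i, ‖b.repr (J u) i‖ ^ 2 with hN
  have hN0 : 0 < N := by
    refine lt_of_le_of_ne (Finset.sum_nonneg fun i _ => sq_nonneg _) fun h0 => hu ?_
    rw [h.form_self_eq_zero (y := u) (by rw [h.form_self, ← hN, ← h0]; simp)]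
    simp
  have hS0 : 0 < S := by
    refine Finset.sum_pos' (fun j _ => Finset.sum_nonneg fun i _ => sq_nonneg _)
      ⟨i, Finset.mem_univ i, ?_⟩
    refine lt_of_le_of_ne (Finset.sum_nonneg fun i _ => sq_nonneg _) fun h0 => hu ?_
    exact h.form_self_eq_zero (by rw [h.form_self, ← h0]; simp)
  refine ⟨S / N, div_pos hS0 hN0, ?_⟩
  have hNc : (N : ℂ) ≠ 0 := by exact_mod_cast hN0.ne'
  push_cast
  field_simp
  exact h1.symm

end IsInvolutiveProduct

/-- Involutive product data for which `ℂ ⊕ V` is an associative `*`-algebra. -/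
structure IsAssocInvolutiveProduct (b : Module.Basis (Fin n) ℂ V) (J : V →ₗ⋆[ℂ] V)
    (t : V ⊗[ℂ] V →ₗ[ℂ] ℂ) (C : V ⊗[ℂ] V →ₗ[ℂ] V) : Prop extends IsInvolutiveProduct b J t C where
  sum_mul : ∑ i, C (b i ⊗ₜ J (b i)) = 0
  form_assoc : ∀ u v w, t (C (u ⊗ₜ v) ⊗ₜ w) = t (u ⊗ₜ C (v ⊗ₜ w))
  assoc : ∀ u v w, C (C (u ⊗ₜ v) ⊗ₜ w) + t (u ⊗ₜ v) • w = C (u ⊗ₜ C (v ⊗ₜ w)) + t (v ⊗ₜ w) • u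

/-- Positivity provides what `exists_relation` requires, and once ω = 1, κ = p(τ - 1) with κ > 0 and
τ > 1 makes p positive. Scaling `C` by 1/√p turns the relation into the associativity condition. -/
lemma IsInvolutiveProduct.exists_assoc [Nontrivial V] (h : IsInvolutiveProduct b J t C)
    (hC : C ≠ 0) (hn : 3 ≤ n) {ω κ κ' ν τ : ℂ}
    (ht : IsTrivalent (TensorProduct.curry t) (TensorProduct.curry C) b (J ∘ b) ω κ κ' ν τ)
    {c : Fin 4 → ℂ} (hc : c ≠ 0)
    (hr : TrilinearRelation (TensorProduct.curry t) (TensorProduct.curry C)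
      (c 0) (c 1) (c 2) (c 3)) :
    ∃ s : ℂ, IsAssocInvolutiveProduct b J t (s • C) := by
  obtain ⟨τ', hτn, hτ'⟩ := h.exists_le_sum_form
  obtain ⟨r, hr0, hκ⟩ := h.exists_kappa_eq hC ht
  obtain rfl : τ = τ' := by rw [← ht.sum_form, ← hτ']; rfl
  have hτ3 : (3 : ℝ) ≤ τ' := le_trans (by exact_mod_cast hn) hτn
  have hC' : TensorProduct.curry C ≠ 0 := fun h0 => hC (TensorProduct.ext h0)
  have hω := ht.omega_ne_zero hC'
  have hκ0 : κ ≠ 0 := by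
    rw [hκ]
    exact mul_ne_zero hω (by exact_mod_cast hr0.ne')
  -- The bound τ' ≥ 3 gives τ² - τ - 1 ≠ 0, τ ≠ 0 and τ ≠ 2.
  obtain ⟨rfl, p, hp, hrel⟩ := ht.exists_relation hC' hκ0
    (by norm_cast; nlinarith) (by norm_cast; linarith) (by norm_cast; linarith) hr (by
      rintro ⟨h0, h1, h2, h3⟩
      apply hc
      ext i
      fin_cases i <;> assumption)
  have hτ1 : 0 < τ' - 1 := by linarith
  obtain ⟨q, hq, rfl⟩ : ∃ q : ℝ, 0 < q ∧ p = q := by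
    refine ⟨r / (τ' - 1), div_pos hr0 hτ1, ?_⟩
    have : (τ' : ℂ) - 1 ≠ 0 := by exact_mod_cast hτ1.ne'
    push_cast
    rw [eq_div_iff this, ← hp, hκ, one_mul]
  set s : ℂ := (((Real.sqrt q)⁻¹ : ℝ) : ℂ) with hs
  have hsq : s * s * q = 1 := by
    rw [hs, ← Complex.ofReal_mul, ← Complex.ofReal_mul, ← Complex.ofReal_one]
    congr 1
    have : Real.sqrt q ≠ 0 := (Real.sqrt_pos.2 hq).ne'
    field_simp
    exact (Real.sq_sqrt hq.le).symm
  refine ⟨s, ⟨h.invol, h.form_eq, fun u v => ?_⟩, ?_, fun u v w => ?_, fun u v w => ?_⟩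
  · rw [LinearMap.smul_apply, map_smulₛₗ, h.map_mul, hs, Complex.conj_ofReal]
    rfl
  · have := ht.sum_mul
    simp only [TensorProduct.curry_apply, Function.comp_apply] at this
    simp [← Finset.smul_sum, this]
  · have := ht.rotate u v w
    simp only [TensorProduct.curry_apply, one_mul] at this
    simp [← TensorProduct.smul_tmul', this]
  · have := hrel u v w
    simp only [TensorProduct.curry_apply] at this
    simp only [LinearMap.smul_apply, ← TensorProduct.smul_tmul', TensorProduct.tmul_smul, map_smul]
    have h2 := congrArg (fun y => (s * s) • y) this
    simp only [smul_add, smul_smul, smul_zero] at h2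
    have e1 : s * s * (q * t (u ⊗ₜ v)) = t (u ⊗ₜ v) := by linear_combination t (u ⊗ₜ v) * hsq
    have e2 : s * s * (-q * t (v ⊗ₜ w)) = - t (v ⊗ₜ w) := by linear_combination -t (v ⊗ₜ w) * hsq
    rw [e1, e2] at h2
    linear_combination (norm := module) h2

end InvolutiveProduct

/-! ### Invariance of the dual tensor -/

section DualTensor

variable {H : Type*} [Ring H] [HopfAlgebra ℂ H] [StarRing H] [StarModule ℂ H]
variable {V : Type*} [AddCommGroup V] [Module ℂ V] {n : ℕ}

/-- The coaction produces the coefficients ∑ᵢ x_ki x_li*, which are δ_kl by unitarity. -/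
lemma IsCoeffMatrix.dualTensor_colinear {ρ : Coaction H V} {b : Module.Basis (Fin n) ℂ V}
    {x : Matrix (Fin n) (Fin n) H} (hb : IsCoeffMatrix ρ b x)
    (hx : x ∈ unitary (Matrix (Fin n) (Fin n) H)) {J : V →ₗ⋆[ℂ] V} (hJ : IsAnticolinear ρ J) :
    IsColinear (trivialCoaction H) (ρ.tensor ρ)
      (LinearMap.toSpanSingleton ℂ _ (dualTensor b J)) := by
  ext
  simp only [LinearMap.comp_apply, LinearMap.toSpanSingleton_apply, one_smul, trivialCoaction,
    LinearMap.flip_apply, TensorProduct.mk_apply, LinearMap.rTensor_tmul, dualTensor, map_sum,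
    Coaction.tensor_tmul, hJ _, hb _, TensorProduct.sum_tmul, TensorProduct.tmul_sum,
    starTensor_tmul, tensorCoactionAux_tmul]
  have h : ∀ k l, ∑ i, (b k ⊗ₜ[ℂ] J (b l)) ⊗ₜ[ℂ] (x k i * star (x l i)) =
      if k = l then (b k ⊗ₜ[ℂ] J (b l)) ⊗ₜ[ℂ] (1 : H) else 0 := fun k l => by
    rw [← TensorProduct.tmul_sum, sum_mul_star_of_mem_unitary hx]
    split_ifs <;> simp
  calc _ = ∑ l, ∑ k, ∑ i, (b k ⊗ₜ[ℂ] J (b l)) ⊗ₜ[ℂ] (x k i * star (x l i)) := by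
        rw [Finset.sum_comm]
        exact Finset.sum_congr rfl fun l _ => Finset.sum_comm
    _ = _ := by
        simp_rw [h]
        simp

end DualTensor

/-! ### Contractions with the dual tensor as colinear maps -/

section Contraction

variable {H : Type*} [Ring H] [HopfAlgebra ℂ H]
variable {V : Type*} [AddCommGroup V] [Module ℂ V] {ρ : Coaction H V}
variable {d : V ⊗[ℂ] V} {t : V ⊗[ℂ] V →ₗ[ℂ] ℂ} {C : V ⊗[ℂ] V →ₗ[ℂ] V}

/-- `v ↦ v ⊗ d` -/
def insertRight (d : V ⊗[ℂ] V) : V →ₗ[ℂ] V ⊗[ℂ] (V ⊗[ℂ] V) :=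
  TensorProduct.map LinearMap.id (LinearMap.toSpanSingleton ℂ _ d) ∘ₗ
    (TensorProduct.rid ℂ V).symm.toLinearMap

/-- `v ↦ d ⊗ v` -/
def insertLeft (U : Type*) [AddCommGroup U] [Module ℂ U] (d : V ⊗[ℂ] V) :
    U →ₗ[ℂ] (V ⊗[ℂ] V) ⊗[ℂ] U :=
  TensorProduct.map (LinearMap.toSpanSingleton ℂ _ d) LinearMap.id ∘ₗ
    (TensorProduct.lid ℂ U).symm.toLinearMap

@[simp] lemma insertRight_apply (d : V ⊗[ℂ] V) (v : V) : insertRight d v = v ⊗ₜ d := by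
  simp [insertRight]

@[simp] lemma insertLeft_apply {U : Type*} [AddCommGroup U] [Module ℂ U] (d : V ⊗[ℂ] V) (v : U) :
    insertLeft U d v = d ⊗ₜ v := by
  simp [insertLeft]

lemma insertRight_colinear
    (hd : IsColinear (trivialCoaction H) (ρ.tensor ρ) (LinearMap.toSpanSingleton ℂ _ d)) :
    IsColinear ρ (ρ.tensor (ρ.tensor ρ)) (insertRight d) :=
  ((IsColinear.id ρ).map hd).comp (IsColinear.symm (IsColinear.rid ρ))

lemma insertLeft_colinear {U : Type*} [AddCommGroup U] [Module ℂ U] (σ : Coaction H U)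
    (hd : IsColinear (trivialCoaction H) (ρ.tensor ρ) (LinearMap.toSpanSingleton ℂ _ d)) :
    IsColinear σ ((ρ.tensor ρ).tensor σ) (insertLeft U d) :=
  (hd.map (IsColinear.id σ)).comp (IsColinear.symm (IsColinear.lid σ))

variable (d C) in
/-- `u ↦ ∑ C (C (u ⊗ d₁) ⊗ d₂)` -/
def contractDualRight : V →ₗ[ℂ] V :=
  C ∘ₗ TensorProduct.map C LinearMap.id ∘ₗ (TensorProduct.assoc ℂ V V V).symm.toLinearMap ∘ₗ
    insertRight d

variable (d C) in
/-- `u ↦ ∑ C (d₁ ⊗ C (d₂ ⊗ u))` -/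
def contractDualLeft : V →ₗ[ℂ] V :=
  C ∘ₗ TensorProduct.map LinearMap.id C ∘ₗ (TensorProduct.assoc ℂ V V V).toLinearMap ∘ₗ
    insertLeft V d

variable (d C) in
/-- `u ⊗ w ↦ ∑ C (C (u ⊗ d₁) ⊗ C (d₂ ⊗ w))` -/
def contractDualMiddle : V ⊗[ℂ] V →ₗ[ℂ] V :=
  C ∘ₗ TensorProduct.map C C ∘ₗ (TensorProduct.assoc ℂ (V ⊗[ℂ] V) V V).toLinearMap ∘ₗ
    TensorProduct.map ((TensorProduct.assoc ℂ V V V).symm.toLinearMap ∘ₗ insertRight d)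
      LinearMap.id

variable (d C t) in
/-- `v ⊗ w ↦ ∑ t (C (d₂ ⊗ v) ⊗ w) • d₁` -/
def rotateProduct : V ⊗[ℂ] V →ₗ[ℂ] V :=
  (TensorProduct.rid ℂ V).toLinearMap ∘ₗ TensorProduct.map LinearMap.id (t ∘ₗ
    TensorProduct.map C LinearMap.id ∘ₗ (TensorProduct.assoc ℂ V V V).symm.toLinearMap) ∘ₗ
    (TensorProduct.assoc ℂ V V (V ⊗[ℂ] V)).toLinearMap ∘ₗ insertLeft (V ⊗[ℂ] V) d

lemma contractDualRight_colinear
    (hd : IsColinear (trivialCoaction H) (ρ.tensor ρ) (LinearMap.toSpanSingleton ℂ _ d))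
    (hC : IsColinear (ρ.tensor ρ) ρ C) : IsColinear ρ ρ (contractDualRight d C) :=
  hC.comp ((hC.map (IsColinear.id ρ)).comp
    ((IsColinear.symm (IsColinear.assoc ρ ρ ρ)).comp (insertRight_colinear hd)))

lemma contractDualLeft_colinear
    (hd : IsColinear (trivialCoaction H) (ρ.tensor ρ) (LinearMap.toSpanSingleton ℂ _ d))
    (hC : IsColinear (ρ.tensor ρ) ρ C) : IsColinear ρ ρ (contractDualLeft d C) :=
  hC.comp (((IsColinear.id ρ).map hC).comp
    ((IsColinear.assoc ρ ρ ρ).comp (insertLeft_colinear ρ hd)))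

lemma contractDualMiddle_colinear
    (hd : IsColinear (trivialCoaction H) (ρ.tensor ρ) (LinearMap.toSpanSingleton ℂ _ d))
    (hC : IsColinear (ρ.tensor ρ) ρ C) : IsColinear (ρ.tensor ρ) ρ (contractDualMiddle d C) :=
  hC.comp ((hC.map hC).comp ((IsColinear.assoc (ρ.tensor ρ) ρ ρ).comp
    (((IsColinear.symm (IsColinear.assoc ρ ρ ρ)).comp (insertRight_colinear hd)).map
      (IsColinear.id ρ))))

lemma rotateProduct_colinear
    (hd : IsColinear (trivialCoaction H) (ρ.tensor ρ) (LinearMap.toSpanSingleton ℂ _ d))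
    (hC : IsColinear (ρ.tensor ρ) ρ C) (ht : IsColinear (ρ.tensor ρ) (trivialCoaction H) t) :
    IsColinear (ρ.tensor ρ) ρ (rotateProduct d t C) :=
  (IsColinear.rid ρ).comp (((IsColinear.id ρ).map (ht.comp ((hC.map (IsColinear.id ρ)).comp
    (IsColinear.symm (IsColinear.assoc ρ ρ ρ))))).comp
      ((IsColinear.assoc ρ ρ (ρ.tensor ρ)).comp (insertLeft_colinear (ρ.tensor ρ) hd)))

end Contraction

/-! ### Trivalent data on W₁ -/

namespace HasSO3Fusion

variable {H : Type u} [Ring H] [HopfAlgebra ℂ H]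
  {W : ℕ → Type v} [∀ n, AddCommGroup (W n)] [∀ n, Module ℂ (W n)] {ρ : ∀ n, Coaction H (W n)}
  {n : ℕ} {b : Module.Basis (Fin n) ℂ (W 1)}
  {J : W 1 →ₗ⋆[ℂ] W 1} {t : W 1 ⊗[ℂ] W 1 →ₗ[ℂ] ℂ} {C : W 1 ⊗[ℂ] W 1 →ₗ[ℂ] W 1}

/-- Each contraction is colinear, so Schur or the uniqueness of `C` makes it a scalar multiple of
the identity or of `C`; the contraction of `C` itself is an invariant vector of W₁, hence 0. -/
lemma exists_isTrivalent (hW : HasSO3Fusion ρ)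
    (h : IsInvolutiveProduct b J t C) (hC : IsColinear ((ρ 1).tensor (ρ 1)) (ρ 1) C)
    (ht : IsColinear ((ρ 1).tensor (ρ 1)) (trivialCoaction H) t)
    (hd : IsColinear (trivialCoaction H) ((ρ 1).tensor (ρ 1))
      (LinearMap.toSpanSingleton ℂ _ (dualTensor b J)))
    (huniq : ∀ f, IsColinear ((ρ 1).tensor (ρ 1)) (ρ 1) f → ∃ c : ℂ, f = c • C) :
    ∃ ω κ κ' ν τ, IsTrivalent (TensorProduct.curry t) (TensorProduct.curry C) b (J ∘ b)
      ω κ κ' ν τ := by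
  obtain ⟨κ, hκ⟩ := hW.exists_smul_id (contractDualRight_colinear hd hC)
  obtain ⟨κ', hκ'⟩ := hW.exists_smul_id (contractDualLeft_colinear hd hC)
  obtain ⟨ν, hν⟩ := huniq _ (contractDualMiddle_colinear hd hC)
  obtain ⟨ω, hω⟩ := huniq _ (rotateProduct_colinear hd hC ht)
  have h0 := hW.invariant_eq_zero (hC.comp hd)
  refine ⟨ω, κ, κ', ν, _, h.sum_left, h.sum_right, fun u v w => ?_, ?_, fun u => ?_, fun u => ?_,
    fun u w => ?_, rfl⟩
  -- Pairing `rotateProduct` with u and expanding u in the dual basis recovers t(C(u, v), w).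
  · have h1 := congrArg (fun y => t (u ⊗ₜ y)) (LinearMap.congr_fun hω (v ⊗ₜ w))
    simp only [rotateProduct, dualTensor, LinearMap.comp_apply, insertLeft_apply,
      TensorProduct.sum_tmul, map_sum, LinearEquiv.coe_coe, TensorProduct.assoc_tmul,
      TensorProduct.map_tmul, TensorProduct.assoc_symm_tmul, TensorProduct.rid_tmul,
      LinearMap.id_apply, TensorProduct.tmul_sum, TensorProduct.tmul_smul, map_smul,
      LinearMap.smul_apply, smul_eq_mul] at h1
    simp only [TensorProduct.curry_apply]
    rw [← h1]
    conv_lhs => rw [← h.sum_right u]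
    simp [TensorProduct.sum_tmul, ← TensorProduct.smul_tmul', mul_comm]
  · simpa [dualTensor] using LinearMap.congr_fun h0 1
  · simpa [contractDualRight, dualTensor, TensorProduct.tmul_sum] using LinearMap.congr_fun hκ u
  · simpa [contractDualLeft, dualTensor, TensorProduct.sum_tmul] using LinearMap.congr_fun hκ' u
  · simpa [contractDualMiddle, dualTensor, TensorProduct.tmul_sum, TensorProduct.sum_tmul] using
      LinearMap.congr_fun hν (u ⊗ₜ w)

/-- Four colinear maps lie in a space spanned by three. -/
lemma exists_trilinearRelation (hW : HasSO3Fusion ρ)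
    (hC : IsColinear ((ρ 1).tensor (ρ 1)) (ρ 1) C)
    (ht : IsColinear ((ρ 1).tensor (ρ 1)) (trivialCoaction H) t) :
    ∃ c : Fin 4 → ℂ, c ≠ 0 ∧ TrilinearRelation (TensorProduct.curry t) (TensorProduct.curry C)
      (c 0) (c 1) (c 2) (c 3) := by
  have hid := IsColinear.id (ρ 1)
  have ha := IsColinear.assoc (ρ 1) (ρ 1) (ρ 1)
  obtain ⟨c, hc, hc0⟩ := hW.exists_trilinear_relation
    ![C ∘ₗ TensorProduct.map C LinearMap.id,
      C ∘ₗ TensorProduct.map LinearMap.id C ∘ₗ (TensorProduct.assoc ℂ _ _ _).toLinearMap,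
      (TensorProduct.lid ℂ _).toLinearMap ∘ₗ TensorProduct.map t LinearMap.id,
      (TensorProduct.rid ℂ _).toLinearMap ∘ₗ TensorProduct.map LinearMap.id t ∘ₗ
        (TensorProduct.assoc ℂ _ _ _).toLinearMap] (by
      intro i
      fin_cases i
      · exact hC.comp (hC.map hid)
      · exact hC.comp ((hid.map hC).comp ha)
      · exact (IsColinear.lid _).comp (ht.map hid)
      · exact (IsColinear.rid _).comp ((hid.map ht).comp ha))
  refine ⟨c, hc0, fun u v w => ?_⟩
  simpa [Fin.sum_univ_four] using LinearMap.congr_fun hc ((u ⊗ₜ v) ⊗ₜ w)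

variable [StarRing H] [StarModule ℂ H] in
theorem exists_isAssocInvolutiveProduct (hW : HasSO3Fusion ρ) (hH : IsCompactHopfAlgebra H) :
    ∃ (n : ℕ) (b : Module.Basis (Fin n) ℂ (W 1)) (J : W 1 →ₗ⋆[ℂ] W 1)
      (t : W 1 ⊗[ℂ] W 1 →ₗ[ℂ] ℂ) (C : W 1 ⊗[ℂ] W 1 →ₗ[ℂ] W 1),
      IsAnticolinear (ρ 1) J ∧ IsColinear ((ρ 1).tensor (ρ 1)) (trivialCoaction H) t ∧
      IsColinear ((ρ 1).tensor (ρ 1)) (ρ 1) C ∧ IsAssocInvolutiveProduct b J t C := by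
  have := hW.finite 1
  have := (hW.simple 1).1
  obtain ⟨b, x, hb, hx⟩ := hH.exists_unitary_basis (ρ 1)
  obtain ⟨t, ht0, ht⟩ := hW.exists_form
  obtain ⟨C, hC0, hC, huniq⟩ := hW.exists_product
  obtain ⟨J, a, z, hJ, hz, h⟩ :=
    hb.exists_isInvolutiveProduct hx (hW.simple 1) ht ht0 hC hC0 huniq
  have hzC : IsColinear ((ρ 1).tensor (ρ 1)) (ρ 1) (z • C) := hC.smul z
  have hat : IsColinear ((ρ 1).tensor (ρ 1)) (trivialCoaction H) (a • t) := ht.smul a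
  obtain ⟨ω, κ, κ', ν, τ, htri⟩ := hW.exists_isTrivalent h hzC hat (hb.dualTensor_colinear hx hJ)
    fun f hf => by
      obtain ⟨c, rfl⟩ := huniq f hf
      exact ⟨c * z⁻¹, by rw [smul_smul, inv_mul_cancel_right₀ hz]⟩
  obtain ⟨c, hc, hr⟩ := hW.exists_trilinearRelation hzC hat
  obtain ⟨s, hs⟩ := h.exists_assoc (smul_ne_zero hz hC0) hW.three_le_finrank htri hc hr
  exact ⟨_, b, J, a • t, s • z • C, hJ, hat, hzC.smul s, hs⟩

end HasSO3Fusion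

/-! ### GNS construction and C*-norm -/

section GNS

open scoped ComplexConjugate

variable {A : Type v} [Ring A] [StarRing A] [Algebra ℂ A] [StarModule ℂ A]

/-- The GNS representation of a faithful state on a finite-dimensional `*`-algebra. -/
theorem IsFaithfulState.exists_faithful_rep [FiniteDimensional ℂ A] {φ : A →ₗ[ℂ] ℂ}
    (hφ : IsFaithfulState φ) (hstar : ∀ a, φ (star a) = conj (φ a)) :
    ∃ (E : Type v) (_ : NormedAddCommGroup E) (_ : InnerProductSpace ℂ E) (_ : CompleteSpace E)
      (f : A →⋆ₐ[ℂ] (E →L[ℂ] E)), Function.Injective f := by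
  let core : InnerProductSpace.Core ℂ A :=
    { inner := fun a b => φ (star a * b)
      conj_inner_symm := fun a b => by rw [← hstar]; simp
      re_inner_nonneg := fun a => (Complex.le_def.1 (hφ.nonneg a)).1
      add_left := fun a b c => by simp [add_mul]
      smul_left := fun a b r => by simp
      definite := fun a ha => hφ.faithful a ha }
  let _ : NormedAddCommGroup A := core.toNormedAddCommGroup
  let _ : InnerProductSpace ℂ A := InnerProductSpace.ofCore core.toCore
  have : CompleteSpace A := FiniteDimensional.complete ℂ A
  have hinner : ∀ a b : A, inner ℂ a b = φ (star a * b) := fun _ _ => rfl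
  let f : A →⋆ₐ[ℂ] (A →L[ℂ] A) :=
    { toFun := fun a => LinearMap.toContinuousLinearMap (LinearMap.mulLeft ℂ a)
      map_one' := by ext x; simp
      map_mul' := fun a b => by ext x; simp
      map_zero' := by ext x; simp
      map_add' := fun a b => by ext x; simp [add_mul]
      commutes' := fun r => by ext x; simp [Algebra.smul_def]
      map_star' := fun a => by
        rw [ContinuousLinearMap.star_eq_adjoint, ContinuousLinearMap.eq_adjoint_iff]
        intro x y
        simp [hinner, mul_assoc] }
  refine ⟨A, inferInstance, inferInstance, inferInstance, f, fun a b hab => ?_⟩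
  -- Left multiplication determines its multiplier through its value at 1.
  have h := DFunLike.congr_fun hab (1 : A)
  simpa [f] using h

/-- The C*-algebra structure on a finite-dimensional `*`-algebra induced by a faithful
representation on a Hilbert space. -/
abbrev cstarAlgebraOfRep [FiniteDimensional ℂ A] {E : Type*} [NormedAddCommGroup E]
    [InnerProductSpace ℂ E] [CompleteSpace E] (f : A →⋆ₐ[ℂ] (E →L[ℂ] E))
    (hf : Function.Injective f) : CStarAlgebra A :=
  letI : NormedRing A := NormedRing.induced A (E →L[ℂ] E) f hf
  letI : NormedAlgebra ℂ A := NormedAlgebra.induced ℂ A (E →L[ℂ] E) f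
  { complete := (FiniteDimensional.complete ℂ A).complete
    norm_mul_self_le := fun a => by
      change ‖f a‖ * ‖f a‖ ≤ ‖f (star a * a)‖
      rw [map_mul, map_star, CStarRing.norm_star_mul_self] }

end GNS

/-! ### The measured *-algebra ℂ ⊕ V -/

section UnitalSum

open scoped ComplexConjugate

variable {V : Type*} [AddCommGroup V] [Module ℂ V] {n : ℕ} {b : Module.Basis (Fin n) ℂ V}
  {J : V →ₗ⋆[ℂ] V} {t : V ⊗[ℂ] V →ₗ[ℂ] ℂ} {C : V ⊗[ℂ] V →ₗ[ℂ] V}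

/-- The algebra `ℂ ⊕ V` with product `(z, u)(w, v) = (zw + t(u, v), zv + wu + C(u, v))`. -/
def UnitalSum (_ : IsAssocInvolutiveProduct b J t C) : Type _ := ℂ × V

namespace UnitalSum

variable (h : IsAssocInvolutiveProduct b J t C)

instance : AddCommGroup (UnitalSum h) := inferInstanceAs (AddCommGroup (ℂ × V))

instance : Module ℂ (UnitalSum h) := inferInstanceAs (Module ℂ (ℂ × V))

/-- The pair `(z, u)` as an element of the algebra. -/
def mk (z : ℂ) (u : V) : UnitalSum h := (z, u)

instance : Mul (UnitalSum h) :=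
  ⟨fun x y => mk h (x.1 * y.1 + t (x.2 ⊗ₜ y.2)) (x.1 • y.2 + y.1 • x.2 + C (x.2 ⊗ₜ y.2))⟩

instance : One (UnitalSum h) := ⟨mk h 1 0⟩

variable {h}

@[ext] lemma ext {x y : UnitalSum h} (h1 : x.1 = y.1) (h2 : x.2 = y.2) : x = y := Prod.ext h1 h2

@[simp] lemma mk_fst (z : ℂ) (u : V) : (mk h z u).1 = z := rfl
@[simp] lemma mk_snd (z : ℂ) (u : V) : (mk h z u).2 = u := rfl
@[simp] lemma add_fst (x y : UnitalSum h) : (x + y).1 = x.1 + y.1 := rfl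
@[simp] lemma add_snd (x y : UnitalSum h) : (x + y).2 = x.2 + y.2 := rfl
@[simp] lemma smul_fst (c : ℂ) (x : UnitalSum h) : (c • x).1 = c * x.1 := rfl
@[simp] lemma smul_snd (c : ℂ) (x : UnitalSum h) : (c • x).2 = c • x.2 := rfl
@[simp] lemma zero_fst : (0 : UnitalSum h).1 = 0 := rfl
@[simp] lemma zero_snd : (0 : UnitalSum h).2 = 0 := rfl
@[simp] lemma one_fst : (1 : UnitalSum h).1 = 1 := rfl
@[simp] lemma one_snd : (1 : UnitalSum h).2 = 0 := rfl
@[simp] lemma mul_fst (x y : UnitalSum h) : (x * y).1 = x.1 * y.1 + t (x.2 ⊗ₜ y.2) := rfl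
@[simp] lemma mul_snd (x y : UnitalSum h) :
    (x * y).2 = x.1 • y.2 + y.1 • x.2 + C (x.2 ⊗ₜ y.2) := rfl

instance : Ring (UnitalSum h) :=
  { (inferInstance : AddCommGroup (UnitalSum h)) with
    left_distrib := fun x y z => by
      ext
      · simp only [mul_fst, add_fst, add_snd, TensorProduct.tmul_add, map_add]
        ring
      · simp only [mul_snd, add_fst, add_snd, TensorProduct.tmul_add, map_add]
        module
    right_distrib := fun x y z => by
      ext
      · simp only [mul_fst, add_fst, add_snd, TensorProduct.add_tmul, map_add]
        ring
      · simp only [mul_snd, add_fst, add_snd, TensorProduct.add_tmul, map_add]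
        module
    zero_mul := fun x => by ext <;> simp
    mul_zero := fun x => by ext <;> simp
    one_mul := fun x => by ext <;> simp
    mul_one := fun x => by ext <;> simp
    mul_assoc := fun x y z => by
      ext
      · simp only [mul_fst, mul_snd, TensorProduct.tmul_add, TensorProduct.add_tmul, map_add,
          TensorProduct.tmul_smul, ← TensorProduct.smul_tmul', map_smul, h.form_assoc, smul_eq_mul]
        ring
      · simp only [mul_fst, mul_snd, TensorProduct.tmul_add, TensorProduct.add_tmul, map_add,
          TensorProduct.tmul_smul, ← TensorProduct.smul_tmul', map_smul]
        linear_combination (norm := module) h.assoc x.2 y.2 z.2 }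

instance : Algebra ℂ (UnitalSum h) :=
  Algebra.ofModule
    (fun c x y => by
      ext
      · simp only [mul_fst, smul_fst, smul_snd, ← TensorProduct.smul_tmul', map_smul, smul_eq_mul]
        ring
      · simp only [mul_snd, smul_fst, smul_snd, ← TensorProduct.smul_tmul', map_smul]
        module)
    (fun c x y => by
      ext
      · simp only [mul_fst, smul_fst, smul_snd, TensorProduct.tmul_smul, map_smul, smul_eq_mul]
        ring
      · simp only [mul_snd, smul_fst, smul_snd, TensorProduct.tmul_smul, map_smul]
        module)

instance : StarRing (UnitalSum h) where
  star x := mk h (conj x.1) (J x.2)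
  star_involutive x := by ext <;> simp [h.invol]
  star_add x y := by ext <;> simp
  star_mul x y := by
    ext
    · simp only [mul_fst, mk_fst, mk_snd, h.form_star, map_add, map_mul]
      ring
    · simp only [mul_snd, mk_fst, mk_snd, ← h.map_mul, map_add, map_smulₛₗ]
      module

@[simp] lemma star_fst (x : UnitalSum h) : (star x).1 = conj x.1 := rfl
@[simp] lemma star_snd (x : UnitalSum h) : (star x).2 = J x.2 := rfl

instance : StarModule ℂ (UnitalSum h) where
  star_smul c x := by ext <;> simp

instance : FiniteDimensional ℂ (UnitalSum h) :=
  have := Module.Basis.finiteDimensional_of_finite b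
  inferInstanceAs (FiniteDimensional ℂ (ℂ × V))

variable (h) in
/-- The projection onto `ℂ`. -/
def state : UnitalSum h →ₗ[ℂ] ℂ := LinearMap.fst ℂ ℂ V

variable (h) in
/-- The projection onto `V`. -/
def proj : UnitalSum h →ₗ[ℂ] V := LinearMap.snd ℂ ℂ V

variable (h) in
/-- The inclusion of `V`. -/
def incl : V →ₗ[ℂ] UnitalSum h := LinearMap.inr ℂ ℂ V

@[simp] lemma state_apply (x : UnitalSum h) : state h x = x.1 := rfl
@[simp] lemma proj_apply (x : UnitalSum h) : proj h x = x.2 := rfl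
@[simp] lemma incl_fst (u : V) : (incl h u).1 = 0 := rfl
@[simp] lemma incl_snd (u : V) : (incl h u).2 = u := rfl

lemma state_star (x : UnitalSum h) : state h (star x) = conj (state h x) := rfl

/-- Since J² = 1, t(J v, v) is the squared norm of v in the orthonormal basis b. -/
lemma state_star_mul_self (x : UnitalSum h) :
    state h (star x * x) = ((‖x.1‖ ^ 2 + ∑ i, ‖b.repr x.2 i‖ ^ 2 : ℝ) : ℂ) := by
  have h1 := h.form_self (J x.2)
  rw [h.invol] at h1
  simp only [state_apply, mul_fst, star_fst, star_snd, h1, Complex.conj_mul']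
  push_cast
  rfl

lemma isFaithfulState : IsFaithfulState (state h) where
  map_one := rfl
  nonneg x := by
    rw [state_star_mul_self, Complex.zero_le_real]
    positivity
  faithful x hx := by
    rw [state_star_mul_self, Complex.ofReal_eq_zero] at hx
    have h2 : 0 ≤ ∑ i, ‖b.repr x.2 i‖ ^ 2 := Finset.sum_nonneg fun i _ => sq_nonneg _
    have h3 : ‖x.1‖ ^ 2 = 0 := by nlinarith [sq_nonneg ‖x.1‖]
    have h4 : ∑ i, ‖b.repr x.2 i‖ ^ 2 = 0 := by nlinarith [sq_nonneg ‖x.1‖]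
    rw [Finset.sum_eq_zero_iff_of_nonneg fun i _ => sq_nonneg _] at h4
    ext
    · simpa using h3
    · apply b.repr.injective
      ext i
      simpa using h4 i (Finset.mem_univ i)

/-- Faithfulness suffices for nondegeneracy: pair x with its own adjoint, on either side. -/
lemma isMeasure : IsMeasure (state h) := by
  constructor
  · intro x hx
    have h1 : star (star x) * star x = x * star x := by rw [star_star]
    rw [← star_star x, isFaithfulState.faithful (star x) (by rw [h1]; exact hx (star x)), star_zero]
  · intro x hx
    exact isFaithfulState.faithful x (hx (star x))

variable (h) in
/-- The dual tensor `1 ⊗ 1 + ∑ bᵢ ⊗ J bᵢ` of the state. -/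
def dual : UnitalSum h ⊗[ℂ] UnitalSum h := 1 ⊗ₜ 1 + ∑ i, incl h (b i) ⊗ₜ incl h (J (b i))

lemma isDualOfForm : IsDualOfForm (state h) (dual h) := by
  constructor
  · intro x
    have h1 : ∑ i, t (x.2 ⊗ₜ b i) • incl h (J (b i)) = incl h x.2 := by
      rw [← h.sum_right x.2, map_sum]
      simp only [map_smul, h.sum_right]
    have h2 : x.1 • (1 : UnitalSum h) + incl h x.2 = x := by ext <;> simp
    simpa [dual, TensorProduct.tmul_add, TensorProduct.tmul_sum, h1] using h2
  · intro x
    have h1 : ∑ i, t (J (b i) ⊗ₜ x.2) • incl h (b i) = incl h x.2 := by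
      rw [← h.sum_left x.2, map_sum]
      simp only [map_smul, h.sum_left]
    have h2 : x.1 • (1 : UnitalSum h) + incl h x.2 = x := by ext <;> simp
    simpa [dual, TensorProduct.add_tmul, TensorProduct.sum_tmul, h1] using h2

/-- The term 1 ⊗ 1 of the dual tensor contributes φ. The others contribute τφ, their part coming
from `C` being t(u, ∑ C(bᵢ, J bᵢ)) = 0. So the constant is 1 + τ, positive since τ ≥ n. -/
lemma isNormalizableMeasure : IsNormalizableMeasure (state h) := by
  obtain ⟨τ, hτn, hτ⟩ := h.exists_le_sum_form
  have hτ0 : (0 : ℝ) < 1 + τ := by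
    have : (0 : ℝ) ≤ n := n.cast_nonneg
    linarith
  refine ⟨⟨dual h, isDualOfForm, ((1 + τ : ℝ) : ℂ), by exact_mod_cast hτ0.ne', ?_⟩, ?_⟩
  · refine LinearMap.ext fun x => ?_
    have h1 : ∀ u : V, ∑ i, t (C (u ⊗ₜ b i) ⊗ₜ J (b i)) = 0 := fun u => by
      simp_rw [h.form_assoc, ← map_sum, ← TensorProduct.tmul_sum, h.sum_mul]
      simp
    have h2 : ∀ u v : V, state h (x * incl h u * incl h v) =
        x.1 * t (u ⊗ₜ v) + t (C (x.2 ⊗ₜ u) ⊗ₜ v) := fun u v => by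
      simp [TensorProduct.add_tmul, ← TensorProduct.smul_tmul']
    have h3 : tildeForm (state h) (dual h) x = state h x +
        ∑ i, state h (x * incl h (b i) * incl h (J (b i))) := by
      simp only [tildeForm, dual, LinearMap.comp_apply, LinearMap.flip_apply,
        LinearMap.add_apply, LinearMap.sum_apply,
        TensorProduct.mk_apply, LinearEquiv.coe_coe, map_add, map_sum, TensorProduct.assoc_symm_tmul,
        LinearMap.rTensor_tmul, LinearMap.mul'_apply, mul_one]
    rw [h3]
    simp_rw [h2]
    rw [Finset.sum_add_distrib, h1, ← Finset.mul_sum, hτ]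
    simp only [state_apply, LinearMap.smul_apply, smul_eq_mul, Complex.ofReal_add,
      Complex.ofReal_one]
    ring
  · simp

section Coaction

variable {H : Type*} [Ring H] [HopfAlgebra ℂ H] {ρ : Coaction H V}

variable (h) in
/-- The coaction on `ℂ ⊕ V`. -/
def coaction (ρ : Coaction H V) : Coaction H (UnitalSum h) := (trivialCoaction H).prod ρ

lemma state_colinear : IsColinear (coaction h ρ) (trivialCoaction H) (state h) :=
  IsColinear.fst _ _

lemma proj_colinear : IsColinear (coaction h ρ) ρ (proj h) := IsColinear.snd _ _

lemma incl_colinear : IsColinear ρ (coaction h ρ) (incl h) := IsColinear.inr _ _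

lemma linearMap_colinear :
    IsColinear (trivialCoaction H) (coaction h ρ) (Algebra.linearMap ℂ (UnitalSum h)) := by
  have h1 : Algebra.linearMap ℂ (UnitalSum h) = LinearMap.inl ℂ ℂ V := by
    refine LinearMap.ext_ring ?_
    rw [Algebra.linearMap_apply, map_one]
    rfl
  rw [h1]
  exact IsColinear.inl _ _

lemma mul_colinear (ht : IsColinear (ρ.tensor ρ) (trivialCoaction H) t)
    (hC : IsColinear (ρ.tensor ρ) ρ C) :
    IsColinear ((coaction h ρ).tensor (coaction h ρ)) (coaction h ρ)
      (LinearMap.mul' ℂ (UnitalSum h)) := by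
  have hs := state_colinear (h := h) (ρ := ρ)
  have hp := proj_colinear (h := h) (ρ := ρ)
  have hi := incl_colinear (h := h) (ρ := ρ)
  have hl := linearMap_colinear (h := h) (ρ := ρ)
  have h1 : LinearMap.mul' ℂ (UnitalSum h) =
      Algebra.linearMap ℂ (UnitalSum h) ∘ₗ
          (TensorProduct.lid ℂ ℂ).toLinearMap ∘ₗ TensorProduct.map (state h) (state h)
        + Algebra.linearMap ℂ (UnitalSum h) ∘ₗ t ∘ₗ TensorProduct.map (proj h) (proj h)
        + incl h ∘ₗ (TensorProduct.lid ℂ V).toLinearMap ∘ₗ TensorProduct.map (state h) (proj h)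
        + incl h ∘ₗ (TensorProduct.rid ℂ V).toLinearMap ∘ₗ TensorProduct.map (proj h) (state h)
        + incl h ∘ₗ C ∘ₗ TensorProduct.map (proj h) (proj h) := by
    refine TensorProduct.ext' fun x y => ?_
    ext <;> simp [Algebra.algebraMap_eq_smul_one]
  rw [h1]
  exact ((((hl.comp ((IsColinear.lid _).comp (hs.map hs))).add
    (hl.comp (ht.comp (hp.map hp)))).add
    (hi.comp ((IsColinear.lid _).comp (hs.map hp)))).add
    (hi.comp ((IsColinear.rid _).comp (hp.map hs)))).add
    (hi.comp (hC.comp (hp.map hp)))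

lemma isMeasuredComoduleAlgebra (ht : IsColinear (ρ.tensor ρ) (trivialCoaction H) t)
    (hC : IsColinear (ρ.tensor ρ) ρ C) :
    IsMeasuredComoduleAlgebra (coaction h ρ) (state h) where
  mul_colinear := mul_colinear ht hC
  unit_colinear := linearMap_colinear
  form_colinear := state_colinear
  isMeasure := isMeasure

/-- On the summand ℂ the coaction is z ↦ z ⊗ 1, and on V the claim is the anticolinearity of J. -/
lemma isStarCoaction [StarRing H] [StarModule ℂ H] (hJ : IsAnticolinear ρ J) :
    IsStarCoaction (coaction h ρ) := by
  intro x
  have h1 : ∀ y : V ⊗[ℂ] H, star ((incl h).rTensor H y) =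
      (incl h).rTensor H (starTensor H J y) := fun y => by
    induction y with
    | zero => simp
    | add y z hy hz => simp only [map_add, star_add, hy, hz]
    | tmul v k =>
      have h2 : star (incl h v) = incl h (J v) := by ext <;> simp
      simp [h2]
  have h3 : ∀ x : UnitalSum h, (coaction h ρ).toLin x =
      (x.1 • (1 : UnitalSum h)) ⊗ₜ 1 + (incl h).rTensor H (ρ.toLin x.2) := fun x => by
    have h4 : x = Algebra.linearMap ℂ (UnitalSum h) x.1 + incl h x.2 := by
      ext <;> simp [Algebra.algebraMap_eq_smul_one]
    conv_lhs => rw [h4, map_add, linearMap_colinear.apply, incl_colinear.apply]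
    simp [trivialCoaction, Algebra.algebraMap_eq_smul_one]
  rw [h3, h3, star_snd, star_fst, hJ, star_add, h1]
  simp

end Coaction

end UnitalSum

end UnitalSum

end

theorem proposition3p1 {H : Type u} [Ring H] [HopfAlgebra ℂ H] [StarRing H] [StarModule ℂ H]
    (hH : IsCompactHopfAlgebra H)
    {W : ℕ → Type v} [∀ n, AddCommGroup (W n)] [∀ n, Module ℂ (W n)]
    (ρ : ∀ n, Coaction H (W n)) (hW : HasSO3Fusion ρ) :
    ∃ (A : Type v) (_ : CStarAlgebra A) (ρA : Coaction H A) (φ : A →ₗ[ℂ] ℂ),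
      ComoduleIso ρA ((trivialCoaction H).prod (ρ 1)) ∧
      IsMeasuredComoduleAlgebra ρA φ ∧
      IsFaithfulState φ ∧
      IsNormalizableMeasure φ ∧
      IsStarCoaction ρA := by
  obtain ⟨n, b, J, t, C, hJ, ht, hC, h⟩ := hW.exists_isAssocInvolutiveProduct hH
  obtain ⟨E, _, _, _, f, hf⟩ :=
    (UnitalSum.isFaithfulState (h := h)).exists_faithful_rep UnitalSum.state_star
  -- The norm is pulled back along the GNS representation and leaves the ring and star structure
  -- unchanged, so the facts proved for `UnitalSum h` apply as they stand.
  exact ⟨UnitalSum h, cstarAlgebraOfRep f hf, UnitalSum.coaction h (ρ 1), UnitalSum.state h,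
    ComoduleIso.refl _, UnitalSum.isMeasuredComoduleAlgebra ht hC, UnitalSum.isFaithfulState,
    UnitalSum.isNormalizableMeasure, UnitalSum.isStarCoaction hJ⟩
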